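/- **Setting.** A concurrent game has states $[n]=\{1,\dots,n\}$, nonempty compact action spaces $A(i)$ (player Min) and $B(i)$ (player Max) for each state $i$, payments $r_i^{ab}\in\mathbb R$ from Min to Max and transition probabilities $P_i^{ab}=(P_{ij}^{ab})_{j\in[n]}$ (stochastic vectors), both continuous in $(a,b)\in A(i)\times B(i)$. It is *unichain* if, for all pure policies $\sigma\in\prod_iA(i)$, $\tau\in\prod_iB(i)$, the digraph of the matrix $P^{\sigma,\tau}=(P_{ij}^{\sigma(i)\tau(i)})_{i,j}$ has a unique final strongly connected component (a final component is one that no arc leaves). Its Shapley operator is $$T_i(v)=\min_{\alpha\in\Delta_{A(i)}}\max_{\beta\in\Delta_{B(i)}}\int\Big(r_i^{ab}+\sum_jP_{ij}^{ab}v_j\Big)\,d\alpha(a)\,d\beta(b),$$ where $\Delta_X$ is the set of probability measures on $X$. The mean-payoff game has value $\chi^*\in\mathbb R^n$ if for every $\delta>0$ there are randomized history-dependent strategies $\sigma^\delta$ of Min and $\tau^\delta$ of Max such that, for all strategies $\sigma,\tau$ and all initial states $i$, $\limsup_N\frac1NJ^N_i(\sigma^\delta,\tau)-\delta\le\chi^*_i\le\liminf_N\frac1NJ^N_i(\sigma,\tau^\delta)+\delta$,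 where $J^N_i$ is the expected total payment received by Max during the first $N$ stages. Let $p_{\min}$ be the minimum of the positive off-diagonal transition probabilities, $p_{\min}=\min\{P_{ij}^{ab}: i\ne j,\ a\in A(i),\ b\in B(i),\ P_{ij}^{ab}>0\}$ (this minimum is assumed to exist; it does if $n\ge2$ and the action spaces are finite), $\theta=p_{\min}/(1+p_{\min})$, $Q^{\sigma,\tau}=\theta I+(1-\theta)P^{\sigma,\tau}$ and $T_\theta=\theta I+(1-\theta)T$. The *unichain index* $k_{\mathrm{uni}}$ is the smallest $k\ge1$ such that, for every product $Q=Q^{\sigma_1,\tau_1}\cdots Q^{\sigma_k,\tau_k}$ with pure policies and all $i_1,i_2\in[n]$, there is $j$ with $Q_{i_1j}>0$ and $Q_{i_2j}>0$. Let $\|r\|_\infty=\max_{i,a,b}|r_i^{ab}|$, $e=(1,\dots,1)$, $\mathbf t(x)=\max_ix_i$, $\mathbf b(x)=\min_ix_i$, $\|x\|_{\mathrm H}=\mathbf t(x)-\mathbf b(x)$. *Relative value iteration* with precision $\epsilon$ and oracle $\tilde T:\mathbb R^n\to\mathbb R^n$: start from $x:=0$; repeat $x:=\tilde T(x)-\mathbf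 t(\tilde T(x))e$ until $\|x-\tilde T(x)\|_{\mathrm H}\le\epsilon/3$; return $x$, $\alpha=\mathbf b(\tilde T(x)-x)$, $\beta=\mathbf t(\tilde T(x)-x)$. The number of iterations is the number of executions of the loop body. **Corollary.** For a unichain concurrent game, the mean-payoff game has a value $\chi e$ that does not depend on the initial state. Let $0<\epsilon<1$, and let $\eta>0$ satisfy $\eta\,\big(12+24\,k_{\mathrm{uni}}/(1-\gamma)\big)\le\epsilon$ with $\gamma=1-\theta^{k_{\mathrm{uni}}}$. Let $\tilde T$ be any oracle with $\|\tilde T(x)-T_\theta(x)\|_\infty\le\eta$ for all $x\in\mathbb R^n$. Then relative value iteration with precision $\epsilon$ and oracle $\tilde T$ terminates after at most $$\max\Big\{1,\ \big(|\log\epsilon|+\log(1-\theta)+\log12+\log\|r\|_\infty\big)\,k_{\mathrm{uni}}\,\theta^{-k_{\mathrm{uni}}}\Big\}$$ iterations (after exactly one iteration if $r=0$). The numbers $\alpha,\beta$ that it returns satisfy $(1-\theta)\chi\in[\alpha-\epsilon/3,\ \beta+\epsilon/3]$, an interval of length at most $\epsilon$, and every $\mu\in[\alpha,\beta]$ provides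 an $\epsilon$-approximation of the value: $\big|\mu/(1-\theta)-\chi\big|\le\epsilon$. -/

import Mathlib

open MeasureTheory ProbabilityTheory Filter

universe u v

noncomputable section

/-- The largest entry of a vector. -/
def topEntry {n : ℕ} (x : Fin n → ℝ) : ℝ := ⨆ i, x i

/-- The smallest entry of a vector. -/
def botEntry {n : ℕ} (x : Fin n → ℝ) : ℝ := ⨅ i, x i

/-- Hilbert's seminorm: largest minus smallest entry. -/
def hilbertSeminorm {n : ℕ} (x : Fin n → ℝ) : ℝ := topEntry x - botEntry x

/-! ### Unichain matrices -/

/-- `j` is accessible from `i` in the digraph with an arc `i → j` whenever `0 < M i j`. -/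
def MatAccess {n : ℕ} (M : Matrix (Fin n) (Fin n) ℝ) (i j : Fin n) : Prop :=
  Relation.ReflTransGen (fun i j => 0 < M i j) i j

/-- `C` is a strongly connected component of the digraph of `M`, and no arc leaves it. -/
def IsFinalClass {n : ℕ} (M : Matrix (Fin n) (Fin n) ℝ) (C : Set (Fin n)) : Prop :=
  (∃ i, C = {j | MatAccess M i j ∧ MatAccess M j i}) ∧ ∀ i ∈ C, ∀ j, 0 < M i j → j ∈ C

/-- The digraph of `M` has a unique final strongly connected component. -/
def MatIsUnichain {n : ℕ} (M : Matrix (Fin n) (Fin n) ℝ) : Prop :=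
  ∃! C : Set (Fin n), IsFinalClass M C

/-! ### Concurrent games -/

/-- A concurrent zero-sum stochastic game with states `Fin n` and action spaces `A i` (player Min)
and `B i` (player Max) in state `i`: instantaneous payments `r i a b` made by Min to Max and
transition probabilities `P i a b j`, both continuous in the pair of actions. -/
structure ConcurrentGame (n : ℕ) (A : Fin n → Type u) (B : Fin n → Type v)
    [∀ i, TopologicalSpace (A i)] [∀ i, TopologicalSpace (B i)] where
  r : ∀ i, A i → B i → ℝ
  P : ∀ i, A i → B i → Fin n → ℝ
  continuous_r : ∀ i, Continuous (fun c : A i × B i => r i c.1 c.2)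
  continuous_P : ∀ i, Continuous (fun c : A i × B i => P i c.1 c.2)
  P_nonneg : ∀ i a b j, 0 ≤ P i a b j
  P_sum : ∀ i a b, ∑ j, P i a b j = 1

/-- What happens at one stage: the current state and the two actions chosen there. -/
abbrev Stage {n : ℕ} (A : Fin n → Type u) (B : Fin n → Type v) : Type (max u v) :=
  Σ i : Fin n, A i × B i

/-- A randomized history-dependent strategy of a player whose action space in state `i` is `X i`,
when one stage is described by an element of `Z`. The history until stage `k` is a pair
`(h, i)`, with `h : Fin k → Z` the previous stages and `i` the current state; `act k i h` is the
law of the action selected at stage `k`, and it depends measurably on the history. -/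
structure Strategy {n : ℕ} (Z : Type*) [MeasurableSpace Z] (X : Fin n → Type*)
    [∀ i, MeasurableSpace (X i)] where
  act : ∀ (k : ℕ) (i : Fin n), Kernel (Fin k → Z) (X i)
  isMarkov : ∀ k i, IsMarkovKernel (act k i)

/-- The iterates of the loop body of relative value iteration with oracle `Tt`, started at `0`:
`x` is replaced by `Tt x - t(Tt x) e`. -/
def rviIterate {n : ℕ} (Tt : (Fin n → ℝ) → (Fin n → ℝ)) : ℕ → (Fin n → ℝ)
  | 0 => 0
  | k + 1 => fun i => Tt (rviIterate Tt k) i - topEntry (Tt (rviIterate Tt k))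

/-- The test of the loop `repeat ... until` of relative value iteration. -/
def RVIStop {n : ℕ} (Tt : (Fin n → ℝ) → (Fin n → ℝ)) (ε : ℝ) (x : Fin n → ℝ) : Prop :=
  hilbertSeminorm (x - Tt x) ≤ ε / 3

/-- Relative value iteration with oracle `Tt` and requested precision `ε` halts after executing
the loop body exactly `N` times and returns `(x, α, β)`. The test is made after each execution
of the loop body, so that `N` is at least `1`. -/
structure RVIReturns {n : ℕ} (Tt : (Fin n → ℝ) → (Fin n → ℝ)) (ε : ℝ)
    (N : ℕ) (x : Fin n → ℝ) (α β : ℝ) : Prop where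
  one_le : 1 ≤ N
  continues : ∀ k, 1 ≤ k → k < N → ¬ RVIStop Tt ε (rviIterate Tt k)
  stops : RVIStop Tt ε (rviIterate Tt N)
  result : x = rviIterate Tt N
  lower : α = botEntry (Tt x - x)
  upper : β = topEntry (Tt x - x)

namespace ConcurrentGame

variable {n : ℕ} {A : Fin n → Type u} {B : Fin n → Type v}
  [∀ i, TopologicalSpace (A i)] [∀ i, TopologicalSpace (B i)]

/-- The transition matrix of a pair of pure policies. -/
def transMatrix (G : ConcurrentGame n A B) (σ : ∀ i, A i) (τ : ∀ i, B i) :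
    Matrix (Fin n) (Fin n) ℝ :=
  Matrix.of fun i j => G.P i (σ i) (τ i) j

/-- The game is unichain: all pairs of pure policies induce unichain transition matrices. -/
def IsUnichain (G : ConcurrentGame n A B) : Prop :=
  ∀ (σ : ∀ i, A i) (τ : ∀ i, B i), MatIsUnichain (G.transMatrix σ τ)

/-- The set of all positive off-diagonal transition probabilities. -/
def offDiagPos (G : ConcurrentGame n A B) : Set ℝ :=
  {p | 0 < p ∧ ∃ (i j : Fin n) (a : A i) (b : B i), i ≠ j ∧ G.P i a b j = p}

/-- The minimal positive off-diagonal transition probability. -/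
def pMin (G : ConcurrentGame n A B) : ℝ := sInf G.offDiagPos

/-- The damping parameter `θ = p_min / (1 + p_min)`. -/
def theta (G : ConcurrentGame n A B) : ℝ := G.pMin / (1 + G.pMin)

/-- The damped transition matrix `Q = θ I + (1 - θ) P` of a pair of pure policies. -/
def dampedMatrix (G : ConcurrentGame n A B) (σ : ∀ i, A i) (τ : ∀ i, B i) :
    Matrix (Fin n) (Fin n) ℝ :=
  G.theta • (1 : Matrix (Fin n) (Fin n) ℝ) + (1 - G.theta) • G.transMatrix σ τ

/-- The set `S_i` of all `j` with a positive entry `(i, j)` in the product `Q_1 ... Q_k` of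
the damped matrices of a sequence of `k` pairs of pure policies. -/
def reachSet (G : ConcurrentGame n A B) {k : ℕ} (σ : Fin k → ∀ i, A i) (τ : Fin k → ∀ i, B i)
    (i : Fin n) : Set (Fin n) :=
  {j | 0 < (List.ofFn fun l => G.dampedMatrix (σ l) (τ l)).prod i j}

/-- The unichain index: the smallest positive `k` such that, for all sequences of `k` pairs of pure
policies, the sets `S_{i₁}` and `S_{i₂}` meet for all states `i₁`, `i₂`. -/
def unichainIndex (G : ConcurrentGame n A B) : ℕ :=
  sInf {k | 1 ≤ k ∧ ∀ (σ : Fin k → ∀ i, A i) (τ : Fin k → ∀ i, B i) (i₁ i₂ : Fin n),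
    (G.reachSet σ τ i₁ ∩ G.reachSet σ τ i₂).Nonempty}

/-- The sup-norm of the payments. -/
def payNorm (G : ConcurrentGame n A B) : ℝ := ⨆ z : Stage A B, |G.r z.1 z.2.1 z.2.2|

variable [∀ i, MeasurableSpace (A i)] [∀ i, MeasurableSpace (B i)]

/-- The expected payment in state `i` when the actions are drawn from `α` and `β`. -/
def mixedPay (G : ConcurrentGame n A B) (i : Fin n) (α : ProbabilityMeasure (A i))
    (β : ProbabilityMeasure (B i)) : ℝ :=
  ∫ c, G.r i c.1 c.2 ∂((α : Measure (A i)).prod (β : Measure (B i)))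

/-- The transition probability from `i` to `j` when the actions are drawn from `α` and `β`. -/
def mixedTrans (G : ConcurrentGame n A B) (i : Fin n) (α : ProbabilityMeasure (A i))
    (β : ProbabilityMeasure (B i)) (j : Fin n) : ℝ :=
  ∫ c, G.P i c.1 c.2 j ∂((α : Measure (A i)).prod (β : Measure (B i)))

/-- The Shapley operator `T` of the game, from randomized actions. -/
def shapley (G : ConcurrentGame n A B) (v : Fin n → ℝ) : Fin n → ℝ := fun i =>
  ⨅ α : ProbabilityMeasure (A i), ⨆ β : ProbabilityMeasure (B i),
    (G.mixedPay i α β + ∑ j, G.mixedTrans i α β j * v j)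

/-- The Krasnoselskii-Mann operator `T_θ = θ I + (1 - θ) T`. -/
def dampedShapley (G : ConcurrentGame n A B) (v : Fin n → ℝ) : Fin n → ℝ :=
  G.theta • v + (1 - G.theta) • G.shapley v

/-- The randomized strategies of player Min. -/
abbrev MinStrategy (_G : ConcurrentGame n A B) := Strategy (Stage A B) A

/-- The randomized strategies of player Max. -/
abbrev MaxStrategy (_G : ConcurrentGame n A B) := Strategy (Stage A B) B

/-- The law of the history until stage `k` of the play started in `i₀`, split by the current
state: `histLaw G σ τ i₀ k i E` is the probability that the previous stages
`(i_l, a_l, b_l)_{l < k}` are in `E` and that `i_k = i`. From the history `(h, i)`, the actions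
`(a, b)` are drawn independently from `σ` and `τ`, and `j` is the next state with probability
`P i a b j`. -/
def histLaw (G : ConcurrentGame n A B) (σ : G.MinStrategy) (τ : G.MaxStrategy) (i₀ : Fin n) :
    (k : ℕ) → Fin n → Measure (Fin k → Stage A B)
  | 0 => fun i => if i = i₀ then Measure.dirac Fin.elim0 else 0
  | k + 1 => fun j => ∑ i,
      (((G.histLaw σ τ i₀ k i) ⊗ₘ (σ.act k i ×ₖ τ.act k i)).withDensity
          fun q => ENNReal.ofReal (G.P i q.2.1 q.2.2 j)).map
        fun q => (Fin.snoc q.1 ⟨i, q.2⟩ : Fin (k + 1) → Stage A B)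

/-- The expectation of the payment made at stage `k` of the play started in `i₀`. -/
def stagePay (G : ConcurrentGame n A B) (σ : G.MinStrategy) (τ : G.MaxStrategy) (i₀ : Fin n)
    (k : ℕ) : ℝ :=
  ∑ i, ∫ q, G.r i q.2.1 q.2.2 ∂((G.histLaw σ τ i₀ k i) ⊗ₘ (σ.act k i ×ₖ τ.act k i))

/-- The expected payment received by Max in horizon `N`. -/
def horizonPay (G : ConcurrentGame n A B) (σ : G.MinStrategy) (τ : G.MaxStrategy) (i₀ : Fin n)
    (N : ℕ) : ℝ :=
  ∑ k ∈ Finset.range N, G.stagePay σ τ i₀ k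

/-- The upper mean payoff of a pair of strategies. -/
def upperMeanPay (G : ConcurrentGame n A B) (σ : G.MinStrategy) (τ : G.MaxStrategy)
    (i₀ : Fin n) : ℝ :=
  limsup (fun N : ℕ => (N : ℝ)⁻¹ * G.horizonPay σ τ i₀ N) atTop

/-- The lower mean payoff of a pair of strategies. -/
def lowerMeanPay (G : ConcurrentGame n A B) (σ : G.MinStrategy) (τ : G.MaxStrategy)
    (i₀ : Fin n) : ℝ :=
  liminf (fun N : ℕ => (N : ℝ)⁻¹ * G.horizonPay σ τ i₀ N) atTop

/-- `χ` is the value of the mean-payoff game: both players have `δ`-optimal strategies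
for every `δ > 0`. -/
def IsMeanPayoffValue (G : ConcurrentGame n A B) (χ : Fin n → ℝ) : Prop :=
  ∀ δ : ℝ, 0 < δ → ∃ (σ' : G.MinStrategy) (τ' : G.MaxStrategy),
    (∀ (τ : G.MaxStrategy) (i : Fin n), G.upperMeanPay σ' τ i - δ ≤ χ i) ∧
    (∀ (σ : G.MinStrategy) (i : Fin n), χ i ≤ G.lowerMeanPay σ τ' i + δ)

end ConcurrentGame

end

/-!
The Shapley operator `T` of a unichain game has an additive eigenvector `T z = z + χ e`, the
eigenvalue `χ` is the value of the mean-payoff game, and relative value iteration converges to it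
geometrically. All this rests on one contraction property, of Hilbert's seminorm by the `k`-th
iterate of `T_θ`, where `k` is the unichain index.

*Contraction.* An increment `T_θ x - T_θ y` is `M (x - y)`, where each row of `M` lies on a
segment between rows of damped matrices of pure policies: the two ends maximize and minimize the
expectation of `x - y`. Thus `M` belongs to the convex hull of the damped matrices
(`ConcurrentGame.exists_mem_convexHull_dampedShapley_sub`). Since products are affine in each
factor, a contraction rate for products of `k` damped matrices holds for products of `k` elements
of their convex hull. By the choice of `θ`, the positive entries of damped matrices are all at
least `θ`, so that any two rows of a product of `k` of them have a common entry that is at least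
`θ ^ k`, and Doeblin's argument gives the rate `1 - θ ^ k`. The unichain index is finite
(`ConcurrentGame.unichainIndex_spec`): as long as the supports of two rows of a product are
disjoint, each new factor enlarges one of them, because two disjoint closed sets would contain two
final classes.

*Value.* By Banach's fixed point theorem, modulo constants, there is an eigenvector `z`. Actions
that are nearly optimal in the one-shot games with continuation payoff `z` form stationary
strategies, and along each play the expected payment of a stage plus the expected variation of `z`
is bounded by `χ`, up to `δ`. Nearly optimal actions for both players come from the minimax
theorem (`exists_approx_saddlePoint`); as the action spaces are compact, this reduces to finite
matrix games. The action spaces are neither metrizable nor Hausdorff in general, and the joint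
measurability of the payments requires an argument (`measurable_of_continuous_prod`).

*Iteration count.* With `y = θ ^ k`, the residual is multiplied by `1 - y` every `k` iterations,
up to noise, and `L / y` such rounds are allowed, where `L` is the logarithm of `12 (1 - θ) ‖r‖ / ε`.
The number of rounds has to be rounded down, so that the estimate `(1 - y) ^ q ≤ exp (-q y)`
falls short by one round. The loss is made up for by the second order term of `log (1 - y)` and by
the fact that the noise accumulated in `q` rounds carries the factor `1 - (1 - y) ^ q`
(`one_sub_pow_mul_exp_le`, `exists_rviResidual_le`).
-/

noncomputable section

/-! ### Hilbert's seminorm -/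

lemma le_topEntry {n : ℕ} (x : Fin n → ℝ) (i : Fin n) : x i ≤ topEntry x :=
  le_ciSup (Set.finite_range x).bddAbove i

lemma botEntry_le {n : ℕ} (x : Fin n → ℝ) (i : Fin n) : botEntry x ≤ x i :=
  ciInf_le (Set.finite_range x).bddBelow i

lemma exists_eq_topEntry {n : ℕ} [Nonempty (Fin n)] (x : Fin n → ℝ) : ∃ i, x i = topEntry x :=
  exists_eq_ciSup_of_finite

lemma exists_eq_botEntry {n : ℕ} [Nonempty (Fin n)] (x : Fin n → ℝ) : ∃ i, x i = botEntry x :=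
  exists_eq_ciInf_of_finite

lemma sub_le_hilbertSeminorm {n : ℕ} (x : Fin n → ℝ) (i j : Fin n) :
    x i - x j ≤ hilbertSeminorm x :=
  sub_le_sub (le_topEntry x i) (botEntry_le x j)

lemma hilbertSeminorm_le_iff {n : ℕ} [Nonempty (Fin n)] {x : Fin n → ℝ} {c : ℝ} :
    hilbertSeminorm x ≤ c ↔ ∀ i j, x i - x j ≤ c := by
  refine ⟨fun h i j => (sub_le_hilbertSeminorm x i j).trans h, fun h => ?_⟩
  obtain ⟨i, hi⟩ := exists_eq_topEntry x
  obtain ⟨j, hj⟩ := exists_eq_botEntry x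
  rw [hilbertSeminorm, ← hi, ← hj]
  exact h i j

lemma hilbertSeminorm_nonneg {n : ℕ} [h : Nonempty (Fin n)] (x : Fin n → ℝ) :
    0 ≤ hilbertSeminorm x := by
  obtain ⟨i⟩ := h
  simpa using sub_le_hilbertSeminorm x i i

lemma hilbertSeminorm_add_le {n : ℕ} [Nonempty (Fin n)] (x y : Fin n → ℝ) :
    hilbertSeminorm (x + y) ≤ hilbertSeminorm x + hilbertSeminorm y := by
  rw [hilbertSeminorm_le_iff]
  intro i j
  have h₁ := sub_le_hilbertSeminorm x i j
  have h₂ := sub_le_hilbertSeminorm y i j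
  simp only [Pi.add_apply]
  linarith

lemma hilbertSeminorm_sub_le_add {n : ℕ} [Nonempty (Fin n)] (x y z : Fin n → ℝ) :
    hilbertSeminorm (x - z) ≤ hilbertSeminorm (x - y) + hilbertSeminorm (y - z) := by
  simpa using hilbertSeminorm_add_le (x - y) (y - z)

lemma hilbertSeminorm_sub_comm {n : ℕ} [Nonempty (Fin n)] (x y : Fin n → ℝ) :
    hilbertSeminorm (x - y) = hilbertSeminorm (y - x) := by
  have key : ∀ x y : Fin n → ℝ, hilbertSeminorm (x - y) ≤ hilbertSeminorm (y - x) := by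
    intro x y
    rw [hilbertSeminorm_le_iff]
    intro i j
    have := sub_le_hilbertSeminorm (y - x) j i
    simp only [Pi.sub_apply] at this ⊢
    linarith
  exact le_antisymm (key x y) (key y x)

lemma hilbertSeminorm_congr {n : ℕ} [Nonempty (Fin n)] {x y : Fin n → ℝ} (c : ℝ)
    (h : ∀ i, x i = y i + c) : hilbertSeminorm x = hilbertSeminorm y := by
  apply le_antisymm <;> rw [hilbertSeminorm_le_iff] <;> intro i j
  · have := sub_le_hilbertSeminorm y i j
    rw [h, h]
    linarith
  · have := sub_le_hilbertSeminorm x i j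
    rw [h, h] at this
    linarith

lemma hilbertSeminorm_le_of_abs_le {n : ℕ} [Nonempty (Fin n)] {x : Fin n → ℝ} {c : ℝ}
    (h : ∀ i, |x i| ≤ c) : hilbertSeminorm x ≤ 2 * c := by
  rw [hilbertSeminorm_le_iff]
  intro i j
  have h₁ := abs_le.1 (h i)
  have h₂ := abs_le.1 (h j)
  linarith

lemma norm_le_hilbertSeminorm {n : ℕ} [Nonempty (Fin n)] {x : Fin n → ℝ} {i₀ : Fin n}
    (hx : x i₀ = 0) : ‖x‖ ≤ hilbertSeminorm x := by
  rw [pi_norm_le_iff_of_nonneg (hilbertSeminorm_nonneg _)]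
  intro i
  rw [Real.norm_eq_abs, abs_le]
  have h₁ := sub_le_hilbertSeminorm x i i₀
  have h₂ := sub_le_hilbertSeminorm x i₀ i
  constructor <;> linarith

lemma hilbertSeminorm_le_norm {n : ℕ} [Nonempty (Fin n)] (x : Fin n → ℝ) :
    hilbertSeminorm x ≤ 2 * ‖x‖ :=
  hilbertSeminorm_le_of_abs_le fun i => norm_le_pi_norm x i

/-! ### A scalar inequality for the iteration count -/

lemma one_sub_le_exp_neg {y : ℝ} (hy0 : 0 ≤ y) (hy1 : y < 1) :
    1 - y ≤ Real.exp (-(y + y ^ 2 / 2)) := by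
  have h := Real.hasSum_pow_div_log_of_abs_lt_one (x := y) (by rw [abs_of_nonneg hy0]; exact hy1)
  have h2 := sum_le_hasSum (Finset.range 2) (fun i _ => by positivity) h
  norm_num [Finset.sum_range_succ] at h2
  rw [← Real.log_le_iff_le_exp (by linarith)]
  linarith

lemma one_sub_pow_le_exp_neg {y : ℝ} (hy0 : 0 ≤ y) (hy1 : y < 1) (q : ℕ) :
    (1 - y) ^ q ≤ Real.exp (-(q * y + q * y * y / 2)) := by
  refine (pow_le_pow_left₀ (by linarith) (one_sub_le_exp_neg hy0 hy1) q).trans_eq ?_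
  rw [← Real.exp_nat_mul]
  congr 1
  ring

/-- This is tight up to `10⁻³`, near `y = 1 / 2` and `t = 1.1`. -/
lemma exp_le_exp_neg_add_exp {y t : ℝ} (hy0 : 0 ≤ y) (hy : y ≤ 1 / 2) :
    Real.exp y ≤ Real.exp (-t) + Real.exp (t * y / 2) := by
  rcases le_total 2 t with ht | ht
  · have h₁ : Real.exp y ≤ Real.exp (t * y / 2) := Real.exp_le_exp.2 (by nlinarith)
    linarith [Real.exp_pos (-t)]
  rcases le_total t 0 with ht0 | ht0
  · have h₁ : 1 - t ≤ Real.exp (-t) := by linarith [Real.add_one_le_exp (-t)]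
    have h₂ : 1 + t * y / 2 ≤ Real.exp (t * y / 2) := by
      linarith [Real.add_one_le_exp (t * y / 2)]
    have h₃ : Real.exp y ≤ Real.exp (1 / 2) := Real.exp_le_exp.2 hy
    have h₄ : Real.exp (1 / 2) ≤ 2 := by
      have := Real.exp_one_lt_d9
      have h5 : Real.exp (1 / 2) ^ 2 = Real.exp 1 := by rw [← Real.exp_nat_mul]; norm_num
      nlinarith [Real.exp_pos (1 / 2)]
    nlinarith
  -- The difference `exp y - exp (t * y / 2)` increases with `y`, so that the case `y = 1 / 2`
  -- is the worst one.
  have hstep : Real.exp y - Real.exp (t * y / 2) ≤ Real.exp (1 / 2) - Real.exp (t / 4) := by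
    have e₁ : Real.exp y = Real.exp (t * y / 2) * Real.exp (y * (1 - t / 2)) := by
      rw [← Real.exp_add]; congr 1; ring
    have e₂ : Real.exp (1 / 2) = Real.exp (t / 4) * Real.exp (1 / 2 * (1 - t / 2)) := by
      rw [← Real.exp_add]; congr 1; ring
    have h₁ : Real.exp (t * y / 2) ≤ Real.exp (t / 4) := Real.exp_le_exp.2 (by nlinarith)
    have h₂ : Real.exp (y * (1 - t / 2)) ≤ Real.exp (1 / 2 * (1 - t / 2)) :=
      Real.exp_le_exp.2 (by nlinarith)
    have h₃ : 1 ≤ Real.exp (y * (1 - t / 2)) := Real.one_le_exp (by nlinarith)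
    rw [e₁, e₂]
    nlinarith [Real.exp_pos (t * y / 2), Real.exp_pos (t / 4)]
  -- With `z = exp (t / 4)`, what remains is `z ^ 4 * exp (1 / 2) ≤ 1 + z ^ 5`, a weighted
  -- inequality of arithmetic and geometric means; `1.3192` is just below the fifth root of `4`.
  have hhalf : Real.exp (1 / 2) ≤ 1.649 := by
    have := Real.exp_one_lt_d9
    have h5 : Real.exp (1 / 2) ^ 2 = Real.exp 1 := by rw [← Real.exp_nat_mul]; norm_num
    nlinarith [Real.exp_pos (1 / 2)]
  set z := Real.exp (t / 4) with hz
  have hz0 : 0 < z := Real.exp_pos _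
  have hzt : Real.exp (-t) * z ^ 4 = 1 := by
    rw [hz, ← Real.exp_nat_mul, ← Real.exp_add]
    simp only [Nat.cast_ofNat, Real.exp_eq_one_iff]
    ring
  have hpoly : 1.649 * z ^ 4 ≤ 1 + z ^ 5 := by
    have h : 0 ≤ (z - 1.3192) ^ 2 *
        (4 * z ^ 3 + 3 * z ^ 2 * 1.3192 + 2 * z * 1.3192 ^ 2 + 1.3192 ^ 3) := by positivity
    nlinarith
  have hkey : 1.649 ≤ Real.exp (-t) + z := by
    have hz4 : 0 < z ^ 4 := by positivity
    refine le_of_mul_le_mul_right ?_ hz4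
    calc 1.649 * z ^ 4 ≤ 1 + z ^ 5 := hpoly
      _ = (Real.exp (-t) + z) * z ^ 4 := by rw [add_mul, hzt]; ring
  linarith

/-- The inequality that makes `⌊L / y⌋` contractions by the factor `1 - y` suffice, where `⌈L / y⌉`
would be the obvious number: the rounding is compensated by the second order term of
`log (1 - y)` and by the noise term `c`. -/
lemma one_sub_pow_mul_exp_le {y L c : ℝ} (hy0 : 0 < y) (hy : y ≤ 1 / 2) {q : ℕ} (hq : 1 ≤ q)
    (hL : L ≤ (q + 1) * y) (hc0 : 0 ≤ c) (hc : c ≤ 1 / 2) :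
    (1 - y) ^ q * (Real.exp L - 1) + c * (2 * (1 - y) ^ q - 1) ≤ 1 := by
  have hq' : (1 : ℝ) ≤ q := by exact_mod_cast hq
  set g := (1 - y) ^ q with hg
  have hg0 : 0 < g := pow_pos (by linarith) q
  have hg1 : g ≤ 1 := pow_le_one₀ (by linarith) (by linarith)
  have hgle : g ≤ Real.exp (-(q * y + q * y * y / 2)) :=
    one_sub_pow_le_exp_neg hy0.le (by linarith) q
  have hexpL : Real.exp L ≤ Real.exp ((q + 1) * y) := Real.exp_le_exp.2 hL
  rcases le_or_gt g (1 / 2) with hghalf | hghalf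
  · suffices h : g * (Real.exp ((q + 1) * y) - 1) ≤ 1 by nlinarith
    have h₁ := exp_le_exp_neg_add_exp (t := q * y) hy0.le hy
    have h₂ : 1 ≤ Real.exp ((q + 1) * y) := Real.one_le_exp (by positivity)
    calc g * (Real.exp ((q + 1) * y) - 1)
        ≤ Real.exp (-(q * y + q * y * y / 2)) * (Real.exp ((q + 1) * y) - 1) :=
          mul_le_mul_of_nonneg_right hgle (by linarith)
      _ = Real.exp (-(q * y * y / 2)) * (Real.exp y - Real.exp (-(q * y))) := by
          rw [mul_sub, mul_sub, mul_one, ← Real.exp_add, ← Real.exp_add, ← Real.exp_add]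
          congr 2 <;> ring
      _ ≤ Real.exp (-(q * y * y / 2)) * Real.exp (q * y * y / 2) :=
          mul_le_mul_of_nonneg_left (by linarith) (Real.exp_pos _).le
      _ = 1 := by rw [← Real.exp_add]; simp
  · have h₁ : g * Real.exp L ≤ Real.exp (3 / 8) := by
      calc g * Real.exp L
          ≤ Real.exp (-(q * y + q * y * y / 2)) * Real.exp ((q + 1) * y) :=
            mul_le_mul hgle hexpL (Real.exp_pos _).le (Real.exp_pos _).le
        _ = Real.exp (y - q * (y * y) / 2) := by rw [← Real.exp_add]; congr 1; ring
        _ ≤ Real.exp (3 / 8) := Real.exp_le_exp.2 (by nlinarith [mul_pos hy0 hy0])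
    have h₂ : Real.exp (3 / 8) ≤ 3 / 2 := by
      by_contra! hlt
      have h₃ : Real.exp (3 / 8) ^ 8 = Real.exp 1 ^ 3 := by
        rw [← Real.exp_nat_mul, ← Real.exp_nat_mul]; norm_num
      have h₄ : (3 / 2 : ℝ) ^ 8 < Real.exp (3 / 8) ^ 8 :=
        pow_lt_pow_left₀ hlt (by norm_num) (by norm_num)
      have h₅ : Real.exp 1 ^ 3 ≤ 2.72 ^ 3 :=
        pow_le_pow_left₀ (Real.exp_pos _).le (by linarith [Real.exp_one_lt_d9]) 3
      rw [h₃] at h₄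
      norm_num at h₄ h₅
      linarith
    nlinarith

/-! ### Continuous payoffs on compact action spaces, and the minimax theorem -/

/-- A probability vector on a finite set of points, as a probability measure. -/
lemma exists_probabilityMeasure_integral_eq_sum {X : Type*} [MeasurableSpace X]
    {s : Finset X} {p : s → ℝ}
    (hp : p ∈ stdSimplex ℝ s) :
    ∃ α : ProbabilityMeasure X, ∀ g : X → ℝ, Measurable g →
      ∫ a, g a ∂(α : Measure X) = ∑ a : s, p a * g a := by
  let μ : Measure X := ∑ a : s, ENNReal.ofReal (p a) • Measure.dirac (a : X)
  have hμ : IsProbabilityMeasure μ := by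
    constructor
    simp only [μ, Measure.coe_finsetSum, Finset.sum_apply, Measure.smul_apply, measure_univ,
      smul_eq_mul, mul_one]
    rw [← ENNReal.ofReal_sum_of_nonneg fun a _ => hp.1 a, hp.2, ENNReal.ofReal_one]
  refine ⟨⟨μ, hμ⟩, fun g hg => ?_⟩
  change ∫ a, g a ∂(∑ a : s, ENNReal.ofReal (p a) • Measure.dirac (a : X)) = _
  rw [integral_finsetSum_measure]
  · refine Finset.sum_congr rfl fun a _ => ?_
    rw [integral_smul_measure, integral_dirac' _ _ hg.stronglyMeasurable,
      ENNReal.toReal_ofReal (hp.1 a), smul_eq_mul]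
  · intro a _
    refine Integrable.smul_measure ?_ ENNReal.ofReal_ne_top
    exact integrable_dirac' hg.stronglyMeasurable (by simp)

lemma integral_le_of_forall_le {X : Type*} [MeasurableSpace X] {μ : Measure X}
    [IsProbabilityMeasure μ] {f : X → ℝ} (hf : Integrable f μ) {c : ℝ} (h : ∀ a, f a ≤ c) :
    ∫ a, f a ∂μ ≤ c := by
  simpa using integral_mono hf (integrable_const c) h

lemma le_integral_of_forall_le {X : Type*} [MeasurableSpace X] {μ : Measure X}
    [IsProbabilityMeasure μ] {f : X → ℝ} (hf : Integrable f μ) {c : ℝ} (h : ∀ a, c ≤ f a) :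
    c ≤ ∫ a, f a ∂μ := by
  simpa using integral_mono (integrable_const c) hf h

/-- Von Neumann's minimax theorem for finite matrix games. -/
lemma exists_matrix_saddlePoint {s t : Type*} [Fintype s] [Fintype t] [Nonempty s] [Nonempty t]
    (M : s → t → ℝ) :
    ∃ p ∈ stdSimplex ℝ s, ∃ q ∈ stdSimplex ℝ t, ∃ c : ℝ,
      (∀ b, ∑ a, p a * M a b ≤ c) ∧ ∀ a, c ≤ ∑ b, q b * M a b := by
  classical
  let f : (s → ℝ) → (t → ℝ) → ℝ := fun p q => ∑ a, p a * ∑ b, q b * M a b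
  have hswap : ∀ p q, f p q = ∑ b, q b * ∑ a, p a * M a b := by
    intro p q
    simp only [f, Finset.mul_sum]
    rw [Finset.sum_comm]
    exact Finset.sum_congr rfl fun _ _ => Finset.sum_congr rfl fun _ _ => by ring
  have hp1 : ∀ a b : ℝ, ∀ p p' : s → ℝ, ∀ q, f (a • p + b • p') q = a * f p q + b * f p' q := by
    intro a b p p' q
    simp only [f, Pi.add_apply, Pi.smul_apply, smul_eq_mul, add_mul, Finset.sum_add_distrib,
      Finset.mul_sum, mul_assoc]
  have hq1 : ∀ a b : ℝ, ∀ p, ∀ q q' : t → ℝ, f p (a • q + b • q') = a * f p q + b * f p q' := by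
    intro a b p q q'
    simp only [hswap, Pi.add_apply, Pi.smul_apply, smul_eq_mul, add_mul, Finset.sum_add_distrib,
      Finset.mul_sum, mul_assoc]
  have ns : (stdSimplex ℝ s).Nonempty :=
    ⟨_, single_mem_stdSimplex ℝ (Classical.arbitrary s)⟩
  have nt : (stdSimplex ℝ t).Nonempty :=
    ⟨_, single_mem_stdSimplex ℝ (Classical.arbitrary t)⟩
  obtain ⟨p, hp, q, hq, hpq⟩ := Sion.exists_isSaddlePointOn (f := f) ns (convex_stdSimplex ℝ s)
    (isCompact_stdSimplex ℝ s)
    (fun q _ =>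
      (by fun_prop : Continuous fun p => f p q).lowerSemicontinuous.lowerSemicontinuousOn _)
    (fun q _ => ConvexOn.quasiconvexOn ⟨convex_stdSimplex ℝ s,
      fun x _ y _ a b _ _ _ => (hp1 a b x y q).le⟩)
    (convex_stdSimplex ℝ t) nt (isCompact_stdSimplex ℝ t)
    (fun p _ =>
      (by fun_prop : Continuous fun q => f p q).upperSemicontinuous.upperSemicontinuousOn _)
    (fun p _ => ConcaveOn.quasiconcaveOn ⟨convex_stdSimplex ℝ t,
      fun x _ y _ a b _ _ _ => (hq1 a b p x y).ge⟩)
  refine ⟨p, hp, q, hq, f p q, fun b => ?_, fun a => ?_⟩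
  · have h := hpq p hp _ (single_mem_stdSimplex ℝ b)
    rw [hswap] at h
    simpa [Pi.single_apply] using h
  · have h := hpq _ (single_mem_stdSimplex ℝ a) q hq
    simpa [f, Pi.single_apply] using h

section Compact

variable {X Y : Type*} [TopologicalSpace X] [TopologicalSpace Y]

/-- Up to `δ`, uniformly in the second variable, finitely many values of the first one suffice. -/
lemma exists_finset_uniform_approx [CompactSpace X] [CompactSpace Y] {f : X → Y → ℝ}
    (hf : Continuous fun c : X × Y => f c.1 c.2) {δ : ℝ} (hδ : 0 < δ) :
    ∃ s : Finset X, ∀ a, ∃ a' ∈ s, ∀ b, |f a b - f a' b| ≤ δ := by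
  let F : C(X, C(Y, ℝ)) := ContinuousMap.curry ⟨fun c : X × Y => f c.1 c.2, hf⟩
  have hF : ∀ a b, F a b = f a b := fun _ _ => rfl
  obtain ⟨s, hs⟩ := CompactSpace.elim_nhds_subcover (fun a' => F ⁻¹' Metric.ball (F a') δ)
    fun a' => F.continuous.continuousAt.preimage_mem_nhds (Metric.ball_mem_nhds _ hδ)
  refine ⟨s, fun a => ?_⟩
  have ha : a ∈ ⋃ a' ∈ s, F ⁻¹' Metric.ball (F a') δ := by rw [hs]; trivial
  simp only [Set.mem_iUnion, Set.mem_preimage, Metric.mem_ball] at ha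
  obtain ⟨a', ha', hd⟩ := ha
  refine ⟨a', ha', fun b => ?_⟩
  rw [← hF, ← hF, ← Real.dist_eq]
  exact (ContinuousMap.dist_apply_le_dist b).trans hd.le

/-- A continuous function on a product of compact spaces is measurable for the product of the Borel
σ-algebras, which may be smaller than the Borel σ-algebra of the product. Indeed it factors through
the image of the first space in `C(Y, ℝ)`, a compact metric space. -/
lemma measurable_of_continuous_prod [CompactSpace X] [CompactSpace Y] [MeasurableSpace X]
    [BorelSpace X] [MeasurableSpace Y] [BorelSpace Y] {f : X → Y → ℝ}
    (hf : Continuous fun c : X × Y => f c.1 c.2) : Measurable fun c : X × Y => f c.1 c.2 := by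
  let F : C(X, C(Y, ℝ)) := ContinuousMap.curry ⟨fun c : X × Y => f c.1 c.2, hf⟩
  let K : Set C(Y, ℝ) := Set.range F
  have : CompactSpace K := isCompact_iff_compactSpace.1 (isCompact_range F.continuous)
  let _ : MeasurableSpace K := borel K
  have : BorelSpace K := ⟨rfl⟩
  have h : Measurable (Function.uncurry fun (k : K) (b : Y) => (k : C(Y, ℝ)) b) :=
    measurable_uncurry_of_continuous_of_measurable
      (fun b => (continuous_eval_const b).comp continuous_subtype_val)
      fun k => k.1.continuous.measurable
  have hFK : Continuous fun a : X => (⟨F a, a, rfl⟩ : K) :=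
    F.continuous.subtype_mk _
  exact h.comp ((hFK.measurable.comp measurable_fst).prodMk measurable_snd)

lemma exists_abs_le_of_continuous [CompactSpace X] {f : X → ℝ} (hf : Continuous f) :
    ∃ C, ∀ a, |f a| ≤ C := by
  obtain ⟨C, hC⟩ := isCompact_univ.exists_bound_of_continuousOn (hf.continuousOn (s := Set.univ))
  exact ⟨C, fun a => hC a trivial⟩

/-- The minimax theorem for a continuous payoff on compact action spaces, up to `δ`: both players
have mixed actions, with finite support, that guarantee `c` up to `δ` against pure actions. -/
lemma exists_approx_saddlePoint [CompactSpace X] [Nonempty X] [MeasurableSpace X] [BorelSpace X]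
    [CompactSpace Y] [Nonempty Y] [MeasurableSpace Y] [BorelSpace Y] {f : X → Y → ℝ}
    (hf : Continuous fun c : X × Y => f c.1 c.2) {δ : ℝ} (hδ : 0 < δ) :
    ∃ (α : ProbabilityMeasure X) (β : ProbabilityMeasure Y) (c : ℝ),
      (∀ b, ∫ a, f a b ∂(α : Measure X) ≤ c + δ) ∧
        ∀ a, c - δ ≤ ∫ b, f a b ∂(β : Measure Y) := by
  obtain ⟨s, hs⟩ := exists_finset_uniform_approx hf hδ
  obtain ⟨t, ht⟩ := exists_finset_uniform_approx (X := Y) (f := fun b a => f a b)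
    (hf.comp continuous_swap) hδ
  obtain ⟨a₀, ha₀, -⟩ := hs (Classical.arbitrary X)
  obtain ⟨b₀, hb₀, -⟩ := ht (Classical.arbitrary Y)
  have : Nonempty s := ⟨⟨a₀, ha₀⟩⟩
  have : Nonempty t := ⟨⟨b₀, hb₀⟩⟩
  obtain ⟨p, hp, q, hq, c, hpc, hqc⟩ := exists_matrix_saddlePoint fun (a : s) (b : t) => f a b
  obtain ⟨α, hα⟩ := exists_probabilityMeasure_integral_eq_sum hp
  obtain ⟨β, hβ⟩ := exists_probabilityMeasure_integral_eq_sum hq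
  refine ⟨α, β, c, fun b => ?_, fun a => ?_⟩
  · rw [hα (fun a => f a b) (Continuous.measurable (hf.comp (Continuous.prodMk_left b)))]
    obtain ⟨b', hb', h⟩ := ht b
    calc ∑ a : s, p a * f a b ≤ ∑ a : s, (p a * f a b' + p a * δ) := by
          refine Finset.sum_le_sum fun a _ => ?_
          rw [← mul_add]
          exact mul_le_mul_of_nonneg_left (by linarith [(abs_le.1 (h a)).2]) (hp.1 a)
      _ = ∑ a : s, p a * f a b' + δ := by
          rw [Finset.sum_add_distrib, ← Finset.sum_mul, hp.2, one_mul]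
      _ ≤ c + δ := by linarith [hpc ⟨b', hb'⟩]
  · rw [hβ (fun b => f a b) (Continuous.measurable (hf.comp (Continuous.prodMk_right a)))]
    obtain ⟨a', ha', h⟩ := hs a
    calc c - δ ≤ ∑ b : t, q b * f a' b - δ := by linarith [hqc ⟨a', ha'⟩]
      _ = ∑ b : t, (q b * f a' b - q b * δ) := by
          rw [Finset.sum_sub_distrib, ← Finset.sum_mul, hq.2, one_mul]
      _ ≤ ∑ b : t, q b * f a b := by
          refine Finset.sum_le_sum fun b _ => ?_
          rw [← mul_sub]
          exact mul_le_mul_of_nonneg_left (by linarith [(abs_le.1 (h b)).1]) (hq.1 b)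

lemma integrable_of_continuous_prod [CompactSpace X] [CompactSpace Y] [MeasurableSpace X]
    [BorelSpace X] [MeasurableSpace Y] [BorelSpace Y] {f : X → Y → ℝ}
    (hf : Continuous fun c : X × Y => f c.1 c.2) (μ : Measure (X × Y)) [IsFiniteMeasure μ] :
    Integrable (fun c : X × Y => f c.1 c.2) μ := by
  obtain ⟨C, hC⟩ := exists_abs_le_of_continuous hf
  exact Integrable.of_bound (measurable_of_continuous_prod hf).aestronglyMeasurable C
    (ae_of_all _ hC)

lemma integral_prod_le_of_forall_left [CompactSpace X] [CompactSpace Y] [MeasurableSpace X]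
    [BorelSpace X] [MeasurableSpace Y] [BorelSpace Y] {f : X → Y → ℝ}
    (hf : Continuous fun c : X × Y => f c.1 c.2) (μ : Measure X) [IsProbabilityMeasure μ]
    (ν : Measure Y) [IsProbabilityMeasure ν] {c : ℝ} (h : ∀ b, ∫ a, f a b ∂μ ≤ c) :
    ∫ z, f z.1 z.2 ∂(μ.prod ν) ≤ c := by
  have hint := integrable_of_continuous_prod hf (μ.prod ν)
  rw [integral_prod_symm _ hint]
  exact integral_le_of_forall_le hint.integral_prod_right h

lemma le_integral_prod_of_forall_right [CompactSpace X] [CompactSpace Y] [MeasurableSpace X]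
    [BorelSpace X] [MeasurableSpace Y] [BorelSpace Y] {f : X → Y → ℝ}
    (hf : Continuous fun c : X × Y => f c.1 c.2) (μ : Measure X) [IsProbabilityMeasure μ]
    (ν : Measure Y) [IsProbabilityMeasure ν] {c : ℝ} (h : ∀ a, c ≤ ∫ b, f a b ∂ν) :
    c ≤ ∫ z, f z.1 z.2 ∂(μ.prod ν) := by
  have hint := integrable_of_continuous_prod hf (μ.prod ν)
  rw [integral_prod _ hint]
  exact le_integral_of_forall_le hint.integral_prod_left h

end Compact

/-! ### The Shapley operator -/

namespace ConcurrentGame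

variable {n : ℕ} {A : Fin n → Type u} {B : Fin n → Type v}
  [∀ i, TopologicalSpace (A i)] [∀ i, TopologicalSpace (B i)]

/-- The payoff of the one-shot game in state `i` with continuation payoff `x`. -/
def oneShot (G : ConcurrentGame n A B) (x : Fin n → ℝ) (i : Fin n) (a : A i) (b : B i) : ℝ :=
  G.r i a b + ∑ j, G.P i a b j * x j

lemma continuous_P_apply (G : ConcurrentGame n A B) (i j : Fin n) :
    Continuous fun c : A i × B i => G.P i c.1 c.2 j :=
  (continuous_apply j).comp (G.continuous_P i)

lemma continuous_oneShot (G : ConcurrentGame n A B) (x : Fin n → ℝ) (i : Fin n) :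
    Continuous fun c : A i × B i => G.oneShot x i c.1 c.2 :=
  (G.continuous_r i).add
    (continuous_finsetSum _ fun j _ => (G.continuous_P_apply i j).mul continuous_const)

variable [∀ i, CompactSpace (A i)] [∀ i, CompactSpace (B i)]

lemma abs_r_le_payNorm (G : ConcurrentGame n A B) (i : Fin n) (a : A i) (b : B i) :
    |G.r i a b| ≤ G.payNorm := by
  choose C hC using fun i => exists_abs_le_of_continuous (G.continuous_r i)
  refine le_ciSup (f := fun z : Stage A B => |G.r z.1 z.2.1 z.2.2|)
    ⟨∑ i, |C i|, ?_⟩ (⟨i, a, b⟩ : Stage A B)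
  rintro _ ⟨⟨i, a, b⟩, rfl⟩
  exact ((hC i (a, b)).trans (le_abs_self _)).trans
    (Finset.single_le_sum (f := fun i => |C i|) (fun _ _ => abs_nonneg _) (Finset.mem_univ i))

variable [∀ i, MeasurableSpace (A i)] [∀ i, MeasurableSpace (B i)]
  [∀ i, BorelSpace (A i)] [∀ i, BorelSpace (B i)]

lemma mixedPay_add_eq_integral (G : ConcurrentGame n A B) (x : Fin n → ℝ) (i : Fin n)
    (α : ProbabilityMeasure (A i)) (β : ProbabilityMeasure (B i)) :
    G.mixedPay i α β + ∑ j, G.mixedTrans i α β j * x j =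
      ∫ c, G.oneShot x i c.1 c.2 ∂((α : Measure (A i)).prod (β : Measure (B i))) := by
  simp only [oneShot, mixedPay, mixedTrans]
  have hP : ∀ j, Integrable (fun c : A i × B i => G.P i c.1 c.2 j * x j)
      ((α : Measure (A i)).prod (β : Measure (B i))) := fun j =>
    (integrable_of_continuous_prod (f := fun a b => G.P i a b j)
      (G.continuous_P_apply i j) _).mul_const _
  rw [integral_add (integrable_of_continuous_prod (G.continuous_r i) _)
    (integrable_finsetSum _ fun j _ => hP j), integral_finsetSum _ fun j _ => hP j]
  simp only [integral_mul_const]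

variable [∀ i, Nonempty (A i)] [∀ i, Nonempty (B i)]

/-- Both players have mixed actions that are optimal up to `δ` in the one-shot game. This is the
form in which the minimax theorem, and the definition of the Shapley operator, are used below. -/
lemma exists_nearOptimal (G : ConcurrentGame n A B) (x : Fin n → ℝ) (i : Fin n) {δ : ℝ}
    (hδ : 0 < δ) :
    ∃ (α : ProbabilityMeasure (A i)) (β : ProbabilityMeasure (B i)),
      (∀ b, ∫ a, G.oneShot x i a b ∂(α : Measure (A i)) ≤ G.shapley x i + δ) ∧
        ∀ a, G.shapley x i - δ ≤ ∫ b, G.oneShot x i a b ∂(β : Measure (B i)) := by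
  have hf := G.continuous_oneShot x i
  obtain ⟨α, β, c, hα, hβ⟩ := exists_approx_saddlePoint hf (half_pos hδ)
  obtain ⟨C, hC⟩ := exists_abs_le_of_continuous hf
  set E : ProbabilityMeasure (A i) → ProbabilityMeasure (B i) → ℝ := fun α β =>
    ∫ z, G.oneShot x i z.1 z.2 ∂((α : Measure (A i)).prod (β : Measure (B i))) with hE
  have hT : G.shapley x i = ⨅ α, ⨆ β, E α β := by
    simp only [shapley, mixedPay_add_eq_integral, hE]
  have hle : ∀ α β, E α β ≤ C := fun α β =>
    integral_le_of_forall_le (integrable_of_continuous_prod hf _) fun z => (abs_le.1 (hC z)).2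
  have hge : ∀ α β, -C ≤ E α β := fun α β =>
    le_integral_of_forall_le (integrable_of_continuous_prod hf _) fun z => (abs_le.1 (hC z)).1
  have hbdd : ∀ α, BddAbove (Set.range (E α)) := fun α =>
    ⟨C, by rintro _ ⟨β, rfl⟩; exact hle α β⟩
  have : Nonempty (ProbabilityMeasure (A i)) := ⟨α⟩
  have : Nonempty (ProbabilityMeasure (B i)) := ⟨β⟩
  have hupper : G.shapley x i ≤ c + δ / 2 := by
    rw [hT]
    refine ciInf_le_of_le ⟨-C, ?_⟩ α (ciSup_le fun β' => ?_)
    · rintro _ ⟨α', rfl⟩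
      exact (hge α' β).trans (le_ciSup (hbdd α') β)
    · exact integral_prod_le_of_forall_left hf _ _ hα
  have hlower : c - δ / 2 ≤ G.shapley x i := by
    rw [hT]
    refine le_ciInf fun α' => le_ciSup_of_le (hbdd α') β ?_
    exact le_integral_prod_of_forall_right hf _ _ hβ
  exact ⟨α, β, fun b => (hα b).trans (by linarith), fun a => le_trans (by linarith) (hβ a)⟩

lemma shapley_le_add (G : ConcurrentGame n A B) {x y : Fin n → ℝ} {i : Fin n} {c : ℝ}
    (h : ∀ a b, G.oneShot x i a b ≤ G.oneShot y i a b + c) :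
    G.shapley x i ≤ G.shapley y i + c := by
  refine le_of_forall_pos_le_add fun δ hδ => ?_
  obtain ⟨-, β, -, hβ⟩ := G.exists_nearOptimal x i (half_pos hδ)
  obtain ⟨α, -, hα, -⟩ := G.exists_nearOptimal y i (half_pos hδ)
  have h₁ := le_integral_prod_of_forall_right (G.continuous_oneShot x i) (α : Measure (A i)) _ hβ
  have h₂ := integral_prod_le_of_forall_left (G.continuous_oneShot y i) _ (β : Measure (B i)) hα
  have hy := integrable_of_continuous_prod (G.continuous_oneShot y i)
    ((α : Measure (A i)).prod (β : Measure (B i)))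
  have h₃ := integral_mono (integrable_of_continuous_prod (G.continuous_oneShot x i) _)
    (hy.add (integrable_const c)) fun z => h z.1 z.2
  have h₄ := integral_add hy (integrable_const c)
  simp only [integral_const, probReal_univ, one_smul] at h₄
  simp only [Pi.add_apply] at h₃
  linarith

lemma abs_shapley_zero_le (G : ConcurrentGame n A B) (i : Fin n) :
    |G.shapley 0 i| ≤ G.payNorm := by
  have hr : ∀ a b, G.oneShot 0 i a b = G.r i a b := by simp [oneShot]
  have hint : ∀ (α : ProbabilityMeasure (A i)) (β : ProbabilityMeasure (B i)),
      Integrable (fun z : A i × B i => G.oneShot 0 i z.1 z.2)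
        ((α : Measure (A i)).prod (β : Measure (B i))) :=
    fun α β => integrable_of_continuous_prod (G.continuous_oneShot 0 i) _
  rw [abs_le]
  constructor <;> refine le_of_forall_pos_le_add fun δ hδ => ?_
  · obtain ⟨α, β, hα, hβ⟩ := G.exists_nearOptimal 0 i hδ
    have h₁ := integral_prod_le_of_forall_left (G.continuous_oneShot 0 i) _
      (β : Measure (B i)) hα
    refine (le_integral_of_forall_le (hint α β) fun z => ?_).trans h₁
    rw [hr]
    exact (abs_le.1 (G.abs_r_le_payNorm i z.1 z.2)).1
  · obtain ⟨α, β, hα, hβ⟩ := G.exists_nearOptimal 0 i hδ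
    have h₁ := le_integral_prod_of_forall_right (G.continuous_oneShot 0 i)
      (α : Measure (A i)) _ hβ
    have h₂ : ∫ z, G.oneShot 0 i z.1 z.2 ∂((α : Measure (A i)).prod (β : Measure (B i))) ≤
        G.payNorm := by
      refine integral_le_of_forall_le (hint α β) fun z => ?_
      rw [hr]
      exact (abs_le.1 (G.abs_r_le_payNorm i z.1 z.2)).2
    linarith

end ConcurrentGame

/-! ### Unichain matrices and products of stochastic matrices -/

/-- The class of a state from which as few states as possible are accessible is final. -/
lemma exists_isFinalClass_subset {n : ℕ} {M : Matrix (Fin n) (Fin n) ℝ} {C : Set (Fin n)}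
    (hC : C.Nonempty) (hclosed : ∀ i ∈ C, ∀ j, 0 < M i j → j ∈ C) :
    ∃ D ⊆ C, D.Nonempty ∧ IsFinalClass M D := by
  obtain ⟨i, hi, hmin⟩ := Set.exists_min_image C (fun i => Set.ncard {j | MatAccess M i j})
    C.toFinite hC
  have hmem : ∀ j, MatAccess M i j → j ∈ C := by
    intro j hj
    induction hj with
    | refl => exact hi
    | tail _ hbc ih => exact hclosed _ ih _ hbc
  have hback : ∀ j, MatAccess M i j → MatAccess M j i := by
    intro j hj
    have hsub : {l | MatAccess M j l} ⊆ {l | MatAccess M i l} := fun l hl => hj.trans hl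
    have heq := Set.eq_of_subset_of_ncard_le hsub (hmin j (hmem j hj)) (Set.toFinite _)
    have : i ∈ {l | MatAccess M i l} := Relation.ReflTransGen.refl
    rwa [← heq] at this
  refine ⟨{j | MatAccess M i j ∧ MatAccess M j i}, fun j hj => hmem j hj.1,
    ⟨i, .refl, .refl⟩, ⟨i, rfl⟩, fun j hj l hjl => ?_⟩
  have hil : MatAccess M i l := hj.1.tail hjl
  exact ⟨hil, hback l hil⟩

lemma MatIsUnichain.inter_nonempty {n : ℕ} {M : Matrix (Fin n) (Fin n) ℝ} (hM : MatIsUnichain M)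
    {C D : Set (Fin n)} (hC : C.Nonempty) (hD : D.Nonempty)
    (hC' : ∀ i ∈ C, ∀ j, 0 < M i j → j ∈ C) (hD' : ∀ i ∈ D, ∀ j, 0 < M i j → j ∈ D) :
    (C ∩ D).Nonempty := by
  obtain ⟨C₁, hC₁, ⟨i, hi⟩, hCf⟩ := exists_isFinalClass_subset hC hC'
  obtain ⟨D₁, hD₁, -, hDf⟩ := exists_isFinalClass_subset hD hD'
  exact ⟨i, hC₁ hi, hD₁ (hM.unique hCf hDf ▸ hi)⟩

/-- The support of a row of a nonnegative matrix. -/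
def rowSupport {n : ℕ} (M : Matrix (Fin n) (Fin n) ℝ) (i : Fin n) : Finset (Fin n) :=
  Finset.univ.filter fun j => 0 < M i j

lemma mem_rowSupport {n : ℕ} {M : Matrix (Fin n) (Fin n) ℝ} {i j : Fin n} :
    j ∈ rowSupport M i ↔ 0 < M i j := by
  simp [rowSupport]

lemma mul_apply_pos {n : ℕ} {M N : Matrix (Fin n) (Fin n) ℝ} (hM : ∀ i j, 0 ≤ M i j)
    (hN : ∀ i j, 0 ≤ N i j) {i l j : Fin n} (hil : 0 < M i l) (hlj : 0 < N l j) :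
    0 < (M * N) i j := by
  rw [Matrix.mul_apply]
  exact Finset.sum_pos' (fun l _ => mul_nonneg (hM i l) (hN l j))
    ⟨l, Finset.mem_univ l, mul_pos hil hlj⟩

/-- If two rows of a product have disjoint supports, then each factor has enlarged one of the two:
otherwise both would be closed for this factor, and disjoint. -/
lemma length_add_two_le_card_rowSupport {n : ℕ} (L : List (Matrix (Fin n) (Fin n) ℝ))
    (hL : ∀ M ∈ L, M ∈ Matrix.rowStochastic ℝ (Fin n) ∧ (∀ i, 0 < M i i) ∧
      ∀ C D : Set (Fin n), C.Nonempty → D.Nonempty → (∀ i ∈ C, ∀ j, 0 < M i j → j ∈ C) →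
        (∀ i ∈ D, ∀ j, 0 < M i j → j ∈ D) → (C ∩ D).Nonempty)
    {i₁ i₂ : Fin n} (hd : Disjoint (rowSupport L.prod i₁) (rowSupport L.prod i₂)) :
    L.length + 2 ≤ (rowSupport L.prod i₁).card + (rowSupport L.prod i₂).card := by
  induction L using List.reverseRecOn with
  | nil =>
    have h : ∀ i : Fin n, 1 ≤ (rowSupport (List.prod []) i).card := fun i =>
      Finset.card_pos.2 ⟨i, mem_rowSupport.2 (by simp)⟩
    have h₁ := h i₁
    have h₂ := h i₂
    simp only [List.length_nil]
    omega
  | append_singleton L M ih =>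
    have hL' := fun N hN => hL N (List.mem_append_left _ hN)
    obtain ⟨hMs, hMd, hMc⟩ := hL M (by simp)
    have hprod : L.prod ∈ Matrix.rowStochastic ℝ (Fin n) :=
      Submonoid.list_prod_mem _ fun N hN => (hL' N hN).1
    have hM0 : ∀ i j, 0 ≤ M i j := fun i j => Matrix.nonneg_of_mem_rowStochastic hMs
    have hP0 : ∀ i j, 0 ≤ L.prod i j := fun i j => Matrix.nonneg_of_mem_rowStochastic hprod
    have hmul : (L ++ [M]).prod = L.prod * M := by simp
    rw [hmul] at hd ⊢
    have hsub : ∀ i, rowSupport L.prod i ⊆ rowSupport (L.prod * M) i := fun i j hj =>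
      mem_rowSupport.2 (mul_apply_pos hP0 hM0 (mem_rowSupport.1 hj) (hMd j))
    have hd' := Finset.disjoint_of_subset_left (hsub i₁) (Finset.disjoint_of_subset_right
      (hsub i₂) hd)
    have ih' := ih hL' hd'
    have hclosed : ∀ i, rowSupport L.prod i = rowSupport (L.prod * M) i →
        ∀ l ∈ (rowSupport L.prod i : Set (Fin n)), ∀ j, 0 < M l j →
          j ∈ (rowSupport L.prod i : Set (Fin n)) := by
      intro i hi l hl j hlj
      rw [hi, Finset.mem_coe, mem_rowSupport]
      exact mul_apply_pos hP0 hM0 (mem_rowSupport.1 (Finset.mem_coe.1 hl)) hlj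
    have hne : ∀ i, (rowSupport L.prod i : Set (Fin n)).Nonempty := by
      intro i
      by_contra hempty
      have hzero : ∀ j, L.prod i j = 0 := fun j => le_antisymm
        (not_lt.1 fun hj => hempty ⟨j, Finset.mem_coe.2 (mem_rowSupport.2 hj)⟩) (hP0 i j)
      have := Matrix.sum_row_of_mem_rowStochastic hprod i
      simp [hzero] at this
    rw [List.length_append, List.length_singleton]
    by_contra hlt
    have hc₁ := Finset.card_le_card (hsub i₁)
    have hc₂ := Finset.card_le_card (hsub i₂)
    have e₁ := Finset.eq_of_subset_of_card_le (hsub i₁) (by omega)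
    have e₂ := Finset.eq_of_subset_of_card_le (hsub i₂) (by omega)
    obtain ⟨j, hj₁, hj₂⟩ := hMc _ _ (hne i₁) (hne i₂) (hclosed i₁ e₁) (hclosed i₂ e₂)
    exact Finset.disjoint_left.1 hd' (Finset.mem_coe.1 hj₁) (Finset.mem_coe.1 hj₂)

lemma pow_length_le_list_prod_apply {n : ℕ} {θ : ℝ} (hθ0 : 0 ≤ θ)
    (L : List (Matrix (Fin n) (Fin n) ℝ))
    (hL : ∀ M ∈ L, M ∈ Matrix.rowStochastic ℝ (Fin n) ∧ ∀ i j, 0 < M i j → θ ≤ M i j)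
    {i j : Fin n} (hij : 0 < L.prod i j) : θ ^ L.length ≤ L.prod i j := by
  induction L generalizing i with
  | nil =>
    rcases eq_or_ne i j with rfl | h
    · simp
    · simp [h] at hij
  | cons M L ih =>
    have hL' := fun N hN => hL N (List.mem_cons_of_mem _ hN)
    obtain ⟨hMs, hMθ⟩ := hL M (by simp)
    have hprod : L.prod ∈ Matrix.rowStochastic ℝ (Fin n) :=
      Submonoid.list_prod_mem _ fun N hN => (hL' N hN).1
    rw [List.prod_cons, Matrix.mul_apply] at hij ⊢
    have hnn : ∀ l, 0 ≤ M i l * L.prod l j := fun l =>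
      mul_nonneg (Matrix.nonneg_of_mem_rowStochastic hMs)
        (Matrix.nonneg_of_mem_rowStochastic hprod)
    obtain ⟨l, -, hl⟩ := Finset.exists_ne_zero_of_sum_ne_zero hij.ne'
    have hM : 0 < M i l := (Matrix.nonneg_of_mem_rowStochastic hMs).lt_of_ne' fun h => by
      simp [h] at hl
    have hP : 0 < L.prod l j := (Matrix.nonneg_of_mem_rowStochastic hprod).lt_of_ne' fun h => by
      simp [h] at hl
    calc θ ^ (M :: L).length = θ * θ ^ L.length := by rw [List.length_cons, pow_succ']
      _ ≤ M i l * L.prod l j :=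
        mul_le_mul (hMθ i l hM) (ih hL' hP) (pow_nonneg hθ0 _) hM.le
      _ ≤ ∑ l, M i l * L.prod l j :=
        Finset.single_le_sum (f := fun l => M i l * L.prod l j) (fun l _ => hnn l)
          (Finset.mem_univ l)

/-- Doeblin's contraction: a stochastic matrix any two rows of which have a common entry `≥ y`
contracts Hilbert's seminorm by the factor `1 - y`. -/
lemma hilbertSeminorm_mulVec_le {n : ℕ} [Nonempty (Fin n)] {M : Matrix (Fin n) (Fin n) ℝ}
    (hM : M ∈ Matrix.rowStochastic ℝ (Fin n)) {y : ℝ}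
    (h : ∀ i₁ i₂, ∃ j, y ≤ M i₁ j ∧ y ≤ M i₂ j) (x : Fin n → ℝ) :
    hilbertSeminorm (M.mulVec x) ≤ (1 - y) * hilbertSeminorm x := by
  rw [hilbertSeminorm_le_iff]
  intro i₁ i₂
  obtain ⟨j, h₁, h₂⟩ := h i₁ i₂
  have hshift : ∀ i c, M.mulVec x i = ∑ l, M i l * (x l - c) + c := by
    intro i c
    simp only [mul_sub, Finset.sum_sub_distrib, ← Finset.sum_mul,
      Matrix.sum_row_of_mem_rowStochastic hM i, Matrix.mulVec, dotProduct]
    ring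
  have hub : M.mulVec x i₁ ≤ y * (x j - topEntry x) + topEntry x := by
    rw [hshift i₁ (topEntry x)]
    have hpos : ∀ l ∈ Finset.univ, 0 ≤ M i₁ l * (topEntry x - x l) := fun l _ =>
      mul_nonneg (Matrix.nonneg_of_mem_rowStochastic hM) (sub_nonneg.2 (le_topEntry x l))
    have hs := Finset.single_le_sum hpos (Finset.mem_univ j)
    have hj := mul_le_mul_of_nonneg_right h₁ (sub_nonneg.2 (le_topEntry x j))
    have hneg : ∑ l, M i₁ l * (x l - topEntry x) = -∑ l, M i₁ l * (topEntry x - x l) := by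
      rw [← Finset.sum_neg_distrib]
      exact Finset.sum_congr rfl fun l _ => by ring
    linarith
  have hlb : y * (x j - botEntry x) + botEntry x ≤ M.mulVec x i₂ := by
    rw [hshift i₂ (botEntry x)]
    have hpos : ∀ l ∈ Finset.univ, 0 ≤ M i₂ l * (x l - botEntry x) := fun l _ =>
      mul_nonneg (Matrix.nonneg_of_mem_rowStochastic hM) (sub_nonneg.2 (botEntry_le x l))
    have hs := Finset.single_le_sum hpos (Finset.mem_univ j)
    have hj := mul_le_mul_of_nonneg_right h₂ (sub_nonneg.2 (botEntry_le x j))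
    linarith
  rw [hilbertSeminorm]
  linarith

/-- A bound on Hilbert's seminorm for products of `k` matrices of a set extends to products of
matrices of its convex hull, because the product is affine in each factor. -/
lemma hilbertSeminorm_list_prod_mulVec_le_of_convexHull {n : ℕ} [Nonempty (Fin n)]
    {S : Set (Matrix (Fin n) (Fin n) ℝ)} {k : ℕ} {x : Fin n → ℝ} {c : ℝ}
    (h : ∀ W : List (Matrix (Fin n) (Fin n) ℝ), W.length = k → (∀ M ∈ W, M ∈ S) →
      hilbertSeminorm (W.prod.mulVec x) ≤ c)
    (L W : List (Matrix (Fin n) (Fin n) ℝ)) (hk : W.length + L.length = k)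
    (hW : ∀ M ∈ W, M ∈ S) (hL : ∀ M ∈ L, M ∈ convexHull ℝ S) :
    hilbertSeminorm ((W.prod * L.prod).mulVec x) ≤ c := by
  induction L generalizing W with
  | nil => simpa using h W (by simpa using hk) hW
  | cons M L ih =>
    let K : Set (Matrix (Fin n) (Fin n) ℝ) :=
      {N | hilbertSeminorm ((W.prod * (N * L.prod)).mulVec x) ≤ c}
    have hK : Convex ℝ K := by
      intro N hN N' hN' a b ha hb hab
      simp only [K, Set.mem_ofPred_eq, hilbertSeminorm_le_iff] at hN hN' ⊢
      intro i j
      have h₁ := mul_le_mul_of_nonneg_left (hN i j) ha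
      have h₂ := mul_le_mul_of_nonneg_left (hN' i j) hb
      simp only [Matrix.add_mul, Matrix.mul_add, Matrix.smul_mul, Matrix.mul_smul,
        Matrix.add_mulVec, Matrix.smul_mulVec, Pi.add_apply, Pi.smul_apply, smul_eq_mul]
      have : c = a * c + b * c := by rw [← add_mul, hab, one_mul]
      linarith
    have hSK : S ⊆ K := by
      intro N hN
      have := ih (W ++ [N]) (by simp at hk ⊢; omega)
        (by
          intro M' hM'
          rcases List.mem_append.1 hM' with h' | h'
          · exact hW M' h'
          · rw [List.mem_singleton.1 h']; exact hN)
        fun M' hM' => hL M' (List.mem_cons_of_mem _ hM')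
      simpa [K, mul_assoc] using this
    simpa [K] using convexHull_min hSK hK (hL M (by simp))

/-! ### The damped matrices and the unichain index -/

namespace ConcurrentGame

variable {n : ℕ} {A : Fin n → Type u} {B : Fin n → Type v}
  [∀ i, TopologicalSpace (A i)] [∀ i, TopologicalSpace (B i)]

lemma P_le_one (G : ConcurrentGame n A B) (i : Fin n) (a : A i) (b : B i) (j : Fin n) :
    G.P i a b j ≤ 1 := by
  rw [← G.P_sum i a b]
  exact Finset.single_le_sum (fun j _ => G.P_nonneg i a b j) (Finset.mem_univ j)

lemma two_le_of_isLeast (G : ConcurrentGame n A B) (hp : IsLeast G.offDiagPos G.pMin) :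
    2 ≤ n := by
  obtain ⟨-, i, j, -, -, hij, -⟩ := hp.1
  have := Fin.val_ne_of_ne hij
  omega

lemma pMin_pos (G : ConcurrentGame n A B) (hp : IsLeast G.offDiagPos G.pMin) : 0 < G.pMin :=
  hp.1.1

lemma theta_pos (G : ConcurrentGame n A B) (hp : IsLeast G.offDiagPos G.pMin) : 0 < G.theta :=
  div_pos (G.pMin_pos hp) (by linarith [G.pMin_pos hp])

lemma theta_le_half (G : ConcurrentGame n A B) (hp : IsLeast G.offDiagPos G.pMin) :
    G.theta ≤ 1 / 2 := by
  have h0 := G.pMin_pos hp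
  have h1 : G.pMin ≤ 1 := by
    obtain ⟨-, i, j, a, b, -, h⟩ := hp.1
    exact h ▸ G.P_le_one i a b j
  rw [theta, div_le_div_iff₀ (by linarith) two_pos]
  linarith

/-- Row `i` of the damped matrix, which depends on the actions in state `i` only. -/
def dampedRow (G : ConcurrentGame n A B) (i : Fin n) (a : A i) (b : B i) : Fin n → ℝ := fun j =>
  G.theta * (1 : Matrix (Fin n) (Fin n) ℝ) i j + (1 - G.theta) * G.P i a b j

lemma dampedMatrix_apply (G : ConcurrentGame n A B) (σ : ∀ i, A i) (τ : ∀ i, B i) (i j : Fin n) :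
    G.dampedMatrix σ τ i j = G.dampedRow i (σ i) (τ i) j := by
  simp [dampedMatrix, dampedRow, transMatrix]

lemma dampedMatrix_mem_rowStochastic (G : ConcurrentGame n A B)
    (hp : IsLeast G.offDiagPos G.pMin) (σ : ∀ i, A i) (τ : ∀ i, B i) :
    G.dampedMatrix σ τ ∈ Matrix.rowStochastic ℝ (Fin n) := by
  have h0 := G.theta_pos hp
  have h1 := G.theta_le_half hp
  rw [dampedMatrix]
  refine Matrix.convex_rowStochastic (one_mem _) ?_ h0.le (by linarith) (by ring)
  rw [SetLike.mem_coe, Matrix.mem_rowStochastic_iff_sum]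
  exact ⟨fun i j => G.P_nonneg _ _ _ _, fun i => G.P_sum _ _ _⟩

lemma theta_le_dampedMatrix_apply_self (G : ConcurrentGame n A B)
    (hp : IsLeast G.offDiagPos G.pMin) (σ : ∀ i, A i) (τ : ∀ i, B i) (i : Fin n) :
    G.theta ≤ G.dampedMatrix σ τ i i := by
  rw [dampedMatrix_apply, dampedRow, Matrix.one_apply_eq]
  have := mul_nonneg (by linarith [G.theta_le_half hp] : 0 ≤ 1 - G.theta)
    (G.P_nonneg i (σ i) (τ i) i)
  linarith

/-- The damping parameter is chosen so that the positive entries of damped matrices are all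
at least `θ`: off the diagonal, they are at least `(1 - θ) p_min = θ`. -/
lemma theta_le_dampedMatrix_apply (G : ConcurrentGame n A B)
    (hp : IsLeast G.offDiagPos G.pMin) (σ : ∀ i, A i) (τ : ∀ i, B i) {i j : Fin n}
    (hij : 0 < G.dampedMatrix σ τ i j) : G.theta ≤ G.dampedMatrix σ τ i j := by
  rcases eq_or_ne i j with rfl | hne
  · exact G.theta_le_dampedMatrix_apply_self hp σ τ i
  have h0 := G.pMin_pos hp
  have h1 : 0 < 1 - G.theta := by linarith [G.theta_le_half hp]
  rw [dampedMatrix_apply, dampedRow, Matrix.one_apply_ne hne, mul_zero, zero_add] at hij ⊢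
  have hP : 0 < G.P i (σ i) (τ i) j := pos_of_mul_pos_right hij h1.le
  have hle : G.pMin ≤ G.P i (σ i) (τ i) j := hp.2 ⟨hP, i, j, _, _, hne, rfl⟩
  calc G.theta = (1 - G.theta) * G.pMin := by
        rw [theta]
        field_simp
        ring
    _ ≤ _ := mul_le_mul_of_nonneg_left hle h1.le

lemma dampedMatrix_apply_pos (G : ConcurrentGame n A B)
    (hp : IsLeast G.offDiagPos G.pMin) (σ : ∀ i, A i) (τ : ∀ i, B i) {i j : Fin n}
    (hij : 0 < G.transMatrix σ τ i j) : 0 < G.dampedMatrix σ τ i j := by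
  have h0 := G.theta_pos hp
  have h1 : 0 < 1 - G.theta := by linarith [G.theta_le_half hp]
  have h2 : 0 ≤ (1 : Matrix (Fin n) (Fin n) ℝ) i j := by
    rw [Matrix.one_apply]
    split_ifs <;> norm_num
  exact add_pos_of_nonneg_of_pos (mul_nonneg h0.le h2) (mul_pos h1 hij)

/-- The unichain index is well defined: `n - 1` factors always suffice. -/
lemma unichainIndex_spec (G : ConcurrentGame n A B) (hG : G.IsUnichain)
    (hp : IsLeast G.offDiagPos G.pMin) :
    1 ≤ G.unichainIndex ∧ ∀ (σ : Fin G.unichainIndex → ∀ i, A i)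
      (τ : Fin G.unichainIndex → ∀ i, B i) (i₁ i₂ : Fin n),
      (G.reachSet σ τ i₁ ∩ G.reachSet σ τ i₂).Nonempty := by
  have hn := G.two_le_of_isLeast hp
  refine Nat.sInf_mem (s := {k | 1 ≤ k ∧ ∀ (σ : Fin k → ∀ i, A i) (τ : Fin k → ∀ i, B i)
    (i₁ i₂ : Fin n), (G.reachSet σ τ i₁ ∩ G.reachSet σ τ i₂).Nonempty}) ⟨n - 1, by omega, ?_⟩
  intro σ τ i₁ i₂
  set L := List.ofFn fun l => G.dampedMatrix (σ l) (τ l) with hL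
  by_contra hempty
  have hd : Disjoint (rowSupport L.prod i₁) (rowSupport L.prod i₂) := by
    rw [Finset.disjoint_left]
    intro j h₁ h₂
    exact hempty ⟨j, mem_rowSupport.1 h₁, mem_rowSupport.1 h₂⟩
  have hcard := length_add_two_le_card_rowSupport L (by
    intro M hM
    obtain ⟨l, rfl⟩ := (List.mem_ofFn' _ _).1 hM
    refine ⟨G.dampedMatrix_mem_rowStochastic hp _ _, fun i =>
      (G.theta_pos hp).trans_le (G.theta_le_dampedMatrix_apply_self hp _ _ i), ?_⟩
    intro C D hC hD hC' hD'
    exact (hG (σ l) (τ l)).inter_nonempty hC hD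
      (fun i hi j hij => hC' i hi j (G.dampedMatrix_apply_pos hp _ _ hij))
      (fun i hi j hij => hD' i hi j (G.dampedMatrix_apply_pos hp _ _ hij))) hd
  rw [← Finset.card_union_of_disjoint hd] at hcard
  have hle := Finset.card_le_univ (rowSupport L.prod i₁ ∪ rowSupport L.prod i₂)
  rw [Fintype.card_fin] at hle
  have hlen : L.length = n - 1 := by rw [hL, List.length_ofFn]
  omega

/-- The damped matrices of pairs of pure policies. -/
def dampedMatrices (G : ConcurrentGame n A B) : Set (Matrix (Fin n) (Fin n) ℝ) :=
  Set.range fun p : (∀ i, A i) × (∀ i, B i) => G.dampedMatrix p.1 p.2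

lemma hilbertSeminorm_list_prod_dampedMatrices_le [Nonempty (Fin n)] (G : ConcurrentGame n A B)
    (hG : G.IsUnichain) (hp : IsLeast G.offDiagPos G.pMin)
    {W : List (Matrix (Fin n) (Fin n) ℝ)} (hlen : W.length = G.unichainIndex)
    (hW : ∀ M ∈ W, M ∈ G.dampedMatrices) (x : Fin n → ℝ) :
    hilbertSeminorm (W.prod.mulVec x) ≤
      (1 - G.theta ^ G.unichainIndex) * hilbertSeminorm x := by
  have hW' : ∀ M ∈ W, M ∈ Matrix.rowStochastic ℝ (Fin n) ∧
      ∀ i j, 0 < M i j → G.theta ≤ M i j := by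
    intro M hM
    obtain ⟨p, rfl⟩ := hW M hM
    exact ⟨G.dampedMatrix_mem_rowStochastic hp _ _,
      fun i j => G.theta_le_dampedMatrix_apply hp _ _⟩
  have hpow : ∀ {i j}, 0 < W.prod i j → G.theta ^ G.unichainIndex ≤ W.prod i j := by
    intro i j hij
    rw [← hlen]
    exact pow_length_le_list_prod_apply (G.theta_pos hp).le W hW' hij
  refine hilbertSeminorm_mulVec_le
    (Submonoid.list_prod_mem _ fun M hM => (hW' M hM).1) (fun i₁ i₂ => ?_) x
  choose p hpq using fun l : Fin W.length => hW (W.get l) (List.get_mem _ _)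
  have hofFn : (List.ofFn fun l : Fin G.unichainIndex =>
      G.dampedMatrix (p (l.cast hlen.symm)).1 (p (l.cast hlen.symm)).2) = W := by
    refine List.ext_get (by simp [hlen]) fun m h₁ h₂ => ?_
    have := hpq ⟨m, h₂⟩
    simpa using this
  obtain ⟨j, h₁, h₂⟩ := (G.unichainIndex_spec hG hp).2
    (fun l => (p (l.cast hlen.symm)).1) (fun l => (p (l.cast hlen.symm)).2) i₁ i₂
  rw [reachSet, Set.mem_ofPred_eq, hofFn] at h₁ h₂
  exact ⟨j, hpow h₁, hpow h₂⟩

end ConcurrentGame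

/-! ### The additive eigenvalue problem -/

/-- A map that commutes with the addition of constants, and an iterate of which contracts Hilbert's
seminorm, has an additive eigenvector. The fixed point theorem is applied to the map on the
hyperplane `x i₀ = 0`, with a further iterate in order to compare Hilbert's seminorm with a norm. -/
lemma exists_additive_eigenvector {n : ℕ} [hn : Nonempty (Fin n)]
    {S : (Fin n → ℝ) → (Fin n → ℝ)} {k : ℕ} {γ : ℝ} (hγ0 : 0 ≤ γ) (hγ1 : γ < 1)
    (hadd : ∀ x (c : ℝ), S (fun i => x i + c) = fun i => S x i + c)
    (hS : ∀ x y, hilbertSeminorm (S^[k] x - S^[k] y) ≤ γ * hilbertSeminorm (x - y)) :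
    ∃ (x : Fin n → ℝ) (c : ℝ), ∀ i, S x i = x i + c := by
  obtain ⟨i₀⟩ := id hn
  let E : Set (Fin n → ℝ) := {x | x i₀ = 0}
  have hE : IsClosed E := isClosed_eq (continuous_apply i₀) continuous_const
  have : CompleteSpace E := hE.completeSpace_coe
  have : Nonempty E := ⟨⟨0, rfl⟩⟩
  let f : E → E := fun x => ⟨fun i => S x i - S x i₀, sub_self _⟩
  have hf : ∀ (m : ℕ) (x : E), ∃ c : ℝ, ∀ i, (f^[m] x : Fin n → ℝ) i = S^[m] x i + c := by
    intro m x
    induction m with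
    | zero => exact ⟨0, fun i => by simp⟩
    | succ m ih =>
      obtain ⟨c, hc⟩ := ih
      have h : S (f^[m] x) = fun i => S (S^[m] x) i + c := by
        rw [show (f^[m] x : Fin n → ℝ) = fun i => S^[m] x i + c from funext hc, hadd]
      refine ⟨c - S (f^[m] x) i₀, fun i => ?_⟩
      rw [Function.iterate_succ_apply', Function.iterate_succ_apply']
      change S (f^[m] x) i - S (f^[m] x) i₀ = _
      rw [show S (f^[m] x) i = S (S^[m] x) i + c from congrFun h i]
      ring
  have hpow : ∀ (m : ℕ) (x y : Fin n → ℝ), hilbertSeminorm (S^[k * m] x - S^[k * m] y) ≤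
      γ ^ m * hilbertSeminorm (x - y) := by
    intro m x y
    induction m with
    | zero => simp
    | succ m ih =>
      rw [Nat.mul_succ, Nat.add_comm, Function.iterate_add_apply, Function.iterate_add_apply]
      calc _ ≤ γ * hilbertSeminorm (S^[k * m] x - S^[k * m] y) := hS _ _
        _ ≤ γ * (γ ^ m * hilbertSeminorm (x - y)) := mul_le_mul_of_nonneg_left ih hγ0
        _ = γ ^ (m + 1) * hilbertSeminorm (x - y) := by ring
  obtain ⟨m, hm⟩ := exists_pow_lt_of_lt_one (show (0 : ℝ) < 1 / 4 by norm_num) hγ1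
  have hcontr : ContractingWith (1 / 2) f^[k * m] := by
    refine ⟨by norm_num, LipschitzWith.of_dist_le_mul fun x y => ?_⟩
    obtain ⟨c, hc⟩ := hf (k * m) x
    obtain ⟨d, hd⟩ := hf (k * m) y
    have h₁ : dist (f^[k * m] x) (f^[k * m] y) ≤
        hilbertSeminorm ((f^[k * m] x : Fin n → ℝ) - (f^[k * m] y : Fin n → ℝ)) := by
      rw [Subtype.dist_eq, dist_eq_norm]
      refine norm_le_hilbertSeminorm (i₀ := i₀) ?_
      rw [Pi.sub_apply, show (f^[k * m] x : Fin n → ℝ) i₀ = 0 from (f^[k * m] x).2,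
        show (f^[k * m] y : Fin n → ℝ) i₀ = 0 from (f^[k * m] y).2, sub_zero]
    have h₂ : hilbertSeminorm ((f^[k * m] x : Fin n → ℝ) - (f^[k * m] y : Fin n → ℝ)) =
        hilbertSeminorm (S^[k * m] x - S^[k * m] y) :=
      hilbertSeminorm_congr (c - d) fun i => by
        simp only [Pi.sub_apply, hc, hd]
        ring
    have h₃ := hilbertSeminorm_le_norm ((x : Fin n → ℝ) - (y : Fin n → ℝ))
    rw [Subtype.dist_eq x y, dist_eq_norm (x : Fin n → ℝ)]
    have h₄ := hpow m x y
    have h₅ := mul_le_mul_of_nonneg_right hm.le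
      (hilbertSeminorm_nonneg ((x : Fin n → ℝ) - (y : Fin n → ℝ)))
    push_cast
    linarith
  have hfix := hcontr.isFixedPt_fixedPoint_iterate
  set x := ContractingWith.fixedPoint f^[k * m] hcontr
  refine ⟨x, S x i₀, fun i => ?_⟩
  have h : S x i - S x i₀ = (x : Fin n → ℝ) i :=
    congrFun (congrArg Subtype.val hfix) i
  linarith

namespace ConcurrentGame

variable {n : ℕ} {A : Fin n → Type u} {B : Fin n → Type v}
  [∀ i, TopologicalSpace (A i)] [∀ i, TopologicalSpace (B i)]
  [∀ i, CompactSpace (A i)] [∀ i, CompactSpace (B i)]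
  [∀ i, MeasurableSpace (A i)] [∀ i, MeasurableSpace (B i)]
  [∀ i, BorelSpace (A i)] [∀ i, BorelSpace (B i)]
  [∀ i, Nonempty (A i)] [∀ i, Nonempty (B i)]

lemma shapley_add_const (G : ConcurrentGame n A B) (x : Fin n → ℝ) (c : ℝ) :
    G.shapley (fun i => x i + c) = fun i => G.shapley x i + c := by
  have h : ∀ i a b, G.oneShot (fun i => x i + c) i a b = G.oneShot x i a b + c := by
    intro i a b
    simp only [oneShot, mul_add, Finset.sum_add_distrib, ← Finset.sum_mul, G.P_sum]
    ring
  funext i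
  apply le_antisymm
  · exact G.shapley_le_add fun a b => (h i a b).le
  · have := G.shapley_le_add (x := x) (y := fun i => x i + c) (i := i) (c := -c)
      fun a b => by rw [h]; linarith
    linarith

lemma dampedShapley_add_const (G : ConcurrentGame n A B) (x : Fin n → ℝ) (c : ℝ) :
    G.dampedShapley (fun i => x i + c) = fun i => G.dampedShapley x i + c := by
  funext i
  simp only [dampedShapley, shapley_add_const, Pi.add_apply, Pi.smul_apply, smul_eq_mul]
  ring

lemma dampedShapley_mono (G : ConcurrentGame n A B) (h0 : 0 ≤ G.theta) (h1 : G.theta ≤ 1)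
    {x y : Fin n → ℝ} (hxy : x ≤ y) : G.dampedShapley x ≤ G.dampedShapley y := by
  intro i
  have h : G.shapley x i ≤ G.shapley y i + 0 := G.shapley_le_add fun a b => by
    rw [add_zero]
    exact add_le_add_right (Finset.sum_le_sum fun j _ =>
      mul_le_mul_of_nonneg_left (hxy j) (G.P_nonneg i a b j)) _
  rw [add_zero] at h
  exact add_le_add (mul_le_mul_of_nonneg_left (hxy i) h0)
    (mul_le_mul_of_nonneg_left h (sub_nonneg.2 h1))

/-- In state `i`, the increment of the Shapley operator is at most its value at a pure action
pair that maximizes the expectation of `x - y`. -/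
lemma exists_shapley_sub_le (G : ConcurrentGame n A B) (x y : Fin n → ℝ) (i : Fin n) :
    ∃ (a : A i) (b : B i), G.shapley x i - G.shapley y i ≤ ∑ j, G.P i a b j * (x j - y j) := by
  have hcont : Continuous fun c : A i × B i => ∑ j, G.P i c.1 c.2 j * (x j - y j) :=
    continuous_finsetSum _ fun j _ => (G.continuous_P_apply i j).mul continuous_const
  obtain ⟨⟨a, b⟩, -, hab⟩ := isCompact_univ.exists_isMaxOn Set.univ_nonempty hcont.continuousOn
  refine ⟨a, b, sub_le_iff_le_add'.2 (G.shapley_le_add fun a' b' => ?_)⟩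
  have h : ∑ j, G.P i a' b' j * (x j - y j) ≤ ∑ j, G.P i a b j * (x j - y j) :=
    hab (Set.mem_univ (a', b'))
  simp only [oneShot, mul_sub, Finset.sum_sub_distrib] at h ⊢
  linarith

/-- The increments of the damped Shapley operator are given by matrices of the convex hull of the
damped matrices of pure policies. -/
lemma exists_mem_convexHull_dampedShapley_sub (G : ConcurrentGame n A B) (h1 : G.theta ≤ 1)
    (x y : Fin n → ℝ) :
    ∃ M ∈ convexHull ℝ G.dampedMatrices,
      G.dampedShapley x - G.dampedShapley y = M.mulVec (x - y) := by
  have hrow : ∀ i a b, dotProduct (G.dampedRow i a b) (x - y) =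
      G.theta * (x i - y i) + (1 - G.theta) * ∑ j, G.P i a b j * (x j - y j) := by
    intro i a b
    simp only [dotProduct, dampedRow, Pi.sub_apply, add_mul, Finset.sum_add_distrib, mul_assoc,
      ← Finset.mul_sum]
    simp [Matrix.one_apply]
  have key : ∀ i, ∃ m ∈ convexHull ℝ (Set.range fun c : A i × B i => G.dampedRow i c.1 c.2),
      (G.dampedShapley x - G.dampedShapley y) i = dotProduct m (x - y) := by
    intro i
    obtain ⟨a, b, hab⟩ := G.exists_shapley_sub_le x y i
    obtain ⟨a', b', hab'⟩ := G.exists_shapley_sub_le y x i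
    have hneg : ∑ j, G.P i a' b' j * (y j - x j) = -∑ j, G.P i a' b' j * (x j - y j) := by
      rw [← Finset.sum_neg_distrib]
      exact Finset.sum_congr rfl fun j _ => by ring
    have hd : (G.dampedShapley x - G.dampedShapley y) i =
        G.theta * (x i - y i) + (1 - G.theta) * (G.shapley x i - G.shapley y i) := by
      simp only [dampedShapley, Pi.sub_apply, Pi.add_apply, Pi.smul_apply, smul_eq_mul]
      ring
    have hmem : (G.dampedShapley x - G.dampedShapley y) i ∈
        Set.Icc (dotProduct (G.dampedRow i a' b') (x - y))
          (dotProduct (G.dampedRow i a b) (x - y)) := by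
      rw [hd, hrow, hrow]
      have h1' : 0 ≤ 1 - G.theta := sub_nonneg.2 h1
      exact ⟨add_le_add_right (mul_le_mul_of_nonneg_left (by linarith) h1') _,
        add_le_add_right (mul_le_mul_of_nonneg_left hab h1') _⟩
    obtain ⟨s, t, hs, ht, hst, heq⟩ := Icc_subset_segment hmem
    refine ⟨s • G.dampedRow i a' b' + t • G.dampedRow i a b,
      convex_convexHull ℝ _ (subset_convexHull ℝ _ (Set.mem_range_self (a', b')))
        (subset_convexHull ℝ _ (Set.mem_range_self (a, b))) hs ht hst, ?_⟩
    rw [add_dotProduct, smul_dotProduct, smul_dotProduct, heq]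
  choose m hm hmd using key
  refine ⟨Matrix.of m, ?_, funext fun i => hmd i⟩
  have hpi : m ∈ convexHull ℝ (Set.univ.pi fun i =>
      Set.range fun c : A i × B i => G.dampedRow i c.1 c.2) :=
    mem_convexHull_pi fun i _ => hm i
  refine convexHull_mono (𝕜 := ℝ) (E := Fin n → Fin n → ℝ) ?_ hpi
  intro N hN
  choose c hc using fun i => hN i (Set.mem_univ i)
  refine ⟨(fun i => (c i).1, fun i => (c i).2), ?_⟩
  ext i j
  change G.dampedMatrix (fun i => (c i).1) (fun i => (c i).2) i j = N i j
  rw [dampedMatrix_apply]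
  exact congrFun (hc i) j

lemma exists_list_iterate_dampedShapley_sub (G : ConcurrentGame n A B) (h1 : G.theta ≤ 1)
    (x y : Fin n → ℝ) (k : ℕ) :
    ∃ L : List (Matrix (Fin n) (Fin n) ℝ), L.length = k ∧
      (∀ M ∈ L, M ∈ convexHull ℝ G.dampedMatrices) ∧
      G.dampedShapley^[k] x - G.dampedShapley^[k] y = L.prod.mulVec (x - y) := by
  induction k with
  | zero => exact ⟨[], rfl, by simp, by simp⟩
  | succ k ih =>
    obtain ⟨L, hlen, hL, heq⟩ := ih
    obtain ⟨M, hM, hMeq⟩ := G.exists_mem_convexHull_dampedShapley_sub h1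
      (G.dampedShapley^[k] x) (G.dampedShapley^[k] y)
    refine ⟨M :: L, by simp [hlen], ?_, ?_⟩
    · intro N hN
      rcases List.mem_cons.1 hN with rfl | h
      · exact hM
      · exact hL N h
    · rw [Function.iterate_succ_apply', Function.iterate_succ_apply', hMeq, heq, List.prod_cons,
        Matrix.mulVec_mulVec]

lemma hilbertSeminorm_iterate_dampedShapley_le [Nonempty (Fin n)] (G : ConcurrentGame n A B)
    (hG : G.IsUnichain) (hp : IsLeast G.offDiagPos G.pMin) (x y : Fin n → ℝ) :
    hilbertSeminorm (G.dampedShapley^[G.unichainIndex] x - G.dampedShapley^[G.unichainIndex] y) ≤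
      (1 - G.theta ^ G.unichainIndex) * hilbertSeminorm (x - y) := by
  obtain ⟨L, hlen, hL, heq⟩ := G.exists_list_iterate_dampedShapley_sub
    (by linarith [G.theta_le_half hp]) x y G.unichainIndex
  rw [heq]
  have := hilbertSeminorm_list_prod_mulVec_le_of_convexHull
    (fun W hW hWS => G.hilbertSeminorm_list_prod_dampedMatrices_le hG hp hW hWS (x - y))
    L [] (by simpa using hlen) (by simp) hL
  simpa using this

/-- Like every monotone map that commutes with the addition of constants, the damped Shapley
operator is nonexpansive for Hilbert's seminorm. -/
lemma hilbertSeminorm_dampedShapley_sub_le [Nonempty (Fin n)] (G : ConcurrentGame n A B)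
    (h0 : 0 ≤ G.theta) (h1 : G.theta ≤ 1) (x y : Fin n → ℝ) :
    hilbertSeminorm (G.dampedShapley x - G.dampedShapley y) ≤ hilbertSeminorm (x - y) := by
  have hub : ∀ i, G.dampedShapley x i ≤ G.dampedShapley y i + topEntry (x - y) := by
    intro i
    have := G.dampedShapley_mono h0 h1 (x := x) (y := fun i => y i + topEntry (x - y))
      (fun j => by have := le_topEntry (x - y) j; simp only [Pi.sub_apply] at this; linarith) i
    rwa [dampedShapley_add_const] at this
  have hlb : ∀ i, G.dampedShapley y i + botEntry (x - y) ≤ G.dampedShapley x i := by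
    intro i
    have := G.dampedShapley_mono h0 h1 (x := fun i => y i + botEntry (x - y)) (y := x)
      (fun j => by have := botEntry_le (x - y) j; simp only [Pi.sub_apply] at this; linarith) i
    rwa [dampedShapley_add_const] at this
  rw [hilbertSeminorm_le_iff]
  intro i j
  have h₁ := hub i
  have h₂ := hlb j
  simp only [Pi.sub_apply, hilbertSeminorm]
  linarith

/-- The ergodic equation `T x = x + χ e`. -/
lemma exists_shapley_eq_add_const (G : ConcurrentGame n A B) (hG : G.IsUnichain)
    (hp : IsLeast G.offDiagPos G.pMin) :
    ∃ (x : Fin n → ℝ) (χ : ℝ), ∀ i, G.shapley x i = x i + χ := by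
  have : Nonempty (Fin n) := ⟨⟨0, by linarith [G.two_le_of_isLeast hp]⟩⟩
  have h0 := G.theta_pos hp
  have h1 := G.theta_le_half hp
  have hpow : G.theta ^ G.unichainIndex ≤ 1 := pow_le_one₀ h0.le (by linarith)
  obtain ⟨x, c, hx⟩ := exists_additive_eigenvector (by linarith)
    (by linarith [pow_pos h0 G.unichainIndex]) G.dampedShapley_add_const
    (G.hilbertSeminorm_iterate_dampedShapley_le hG hp)
  refine ⟨x, c / (1 - G.theta), fun i => ?_⟩
  have h2 : 1 - G.theta ≠ 0 := by linarith
  have := hx i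
  simp only [dampedShapley, Pi.add_apply, Pi.smul_apply, smul_eq_mul] at this
  field_simp
  linarith

end ConcurrentGame

/-! ### Stationary strategies and the value of the mean-payoff game -/

instance Strategy.isMarkovKernel_act {n : ℕ} {Z : Type*} [MeasurableSpace Z] {X : Fin n → Type*}
    [∀ i, MeasurableSpace (X i)] (σ : Strategy Z X) (k : ℕ) (i : Fin n) :
    IsMarkovKernel (σ.act k i) :=
  σ.isMarkov k i

/-- The strategy that draws the action from `α i` whenever the state is `i`. -/
def Strategy.stationary {n : ℕ} (Z : Type*) [MeasurableSpace Z] {X : Fin n → Type*}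
    [∀ i, MeasurableSpace (X i)] (α : ∀ i, ProbabilityMeasure (X i)) : Strategy Z X where
  act _ i := Kernel.const _ (α i : Measure (X i))
  isMarkov _ _ := inferInstance

lemma measurable_snoc_stage {n : ℕ} {A : Fin n → Type u} {B : Fin n → Type v}
    [∀ i, MeasurableSpace (A i)] [∀ i, MeasurableSpace (B i)] (k : ℕ) (i : Fin n) :
    Measurable fun q : (Fin k → Stage A B) × (A i × B i) =>
      (Fin.snoc q.1 ⟨i, q.2⟩ : Fin (k + 1) → Stage A B) := by
  have hmk : Measurable fun c : A i × B i => (⟨i, c⟩ : Stage A B) :=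
    fun s hs =>
    MeasurableSpace.measurableSet_iInf.1 hs i
  refine measurable_pi_iff.2 fun l => ?_
  refine Fin.lastCases ?_ (fun l => ?_) l
  · simp only [Fin.snoc_last]
    exact hmk.comp measurable_snd
  · simp only [Fin.snoc_castSucc]
    exact (measurable_pi_apply l).comp measurable_fst

namespace ConcurrentGame

variable {n : ℕ} {A : Fin n → Type u} {B : Fin n → Type v}
  [∀ i, TopologicalSpace (A i)] [∀ i, TopologicalSpace (B i)]
  [∀ i, MeasurableSpace (A i)] [∀ i, MeasurableSpace (B i)]

lemma histLaw_succ_apply_univ (G : ConcurrentGame n A B) (σ : G.MinStrategy) (τ : G.MaxStrategy)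
    (i₀ : Fin n) (k : ℕ) (j : Fin n) :
    G.histLaw σ τ i₀ (k + 1) j Set.univ =
      ∑ i, ∫⁻ q, ENNReal.ofReal (G.P i q.2.1 q.2.2 j)
        ∂((G.histLaw σ τ i₀ k i) ⊗ₘ (σ.act k i ×ₖ τ.act k i)) := by
  rw [histLaw, Measure.coe_finsetSum, Finset.sum_apply]
  refine Finset.sum_congr rfl fun i _ => ?_
  rw [Measure.map_apply (measurable_snoc_stage k i) MeasurableSet.univ, Set.preimage_univ,
    withDensity_apply _ MeasurableSet.univ, Measure.restrict_univ]

variable [∀ i, CompactSpace (A i)] [∀ i, CompactSpace (B i)]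
  [∀ i, BorelSpace (A i)] [∀ i, BorelSpace (B i)]

instance isFiniteMeasure_histLaw (G : ConcurrentGame n A B) (σ : G.MinStrategy)
    (τ : G.MaxStrategy) (i₀ : Fin n) (k : ℕ) (i : Fin n) :
    IsFiniteMeasure (G.histLaw σ τ i₀ k i) := by
  induction k generalizing i with
  | zero =>
    simp only [histLaw]
    split_ifs <;> infer_instance
  | succ k ih =>
    refine ⟨?_⟩
    rw [histLaw_succ_apply_univ]
    refine ENNReal.sum_lt_top.2 fun l _ => ?_
    have := ih l
    refine lt_of_le_of_lt (lintegral_mono (g := fun _ => 1) fun q => ?_) ?_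
    · exact ENNReal.ofReal_le_one.2 (G.P_le_one _ _ _ _)
    · rw [lintegral_one]
      exact measure_lt_top _ _

lemma integrable_comp_snd (i : Fin n) {Z : Type*} [MeasurableSpace Z] {f : A i → B i → ℝ}
    (hf : Continuous fun c : A i × B i => f c.1 c.2) (μ : Measure (Z × (A i × B i)))
    [IsFiniteMeasure μ] : Integrable (fun q => f q.2.1 q.2.2) μ := by
  obtain ⟨C, hC⟩ := exists_abs_le_of_continuous hf
  exact Integrable.of_bound
    ((measurable_of_continuous_prod hf).comp measurable_snd).aestronglyMeasurable C
    (ae_of_all _ fun q => hC q.2)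

/-- The expectation of `x` in the state reached at stage `k`. -/
def expectedPotential (G : ConcurrentGame n A B) (σ : G.MinStrategy) (τ : G.MaxStrategy)
    (i₀ : Fin n) (x : Fin n → ℝ) (k : ℕ) : ℝ :=
  ∑ i, (G.histLaw σ τ i₀ k i).real Set.univ * x i

lemma histLaw_succ_real_univ (G : ConcurrentGame n A B) (σ : G.MinStrategy) (τ : G.MaxStrategy)
    (i₀ : Fin n) (k : ℕ) (j : Fin n) :
    (G.histLaw σ τ i₀ (k + 1) j).real Set.univ =
      ∑ i, ∫ q, G.P i q.2.1 q.2.2 j ∂((G.histLaw σ τ i₀ k i) ⊗ₘ (σ.act k i ×ₖ τ.act k i)) := by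
  rw [measureReal_def, histLaw_succ_apply_univ, ENNReal.toReal_sum]
  · refine Finset.sum_congr rfl fun i _ => ?_
    rw [integral_eq_lintegral_of_nonneg_ae (ae_of_all _ fun q => G.P_nonneg i _ _ j)
      (integrable_comp_snd i (f := fun a b => G.P i a b j) (G.continuous_P_apply i j)
        _).aestronglyMeasurable]
  · intro i _
    exact (integrable_comp_snd i (f := fun a b => G.P i a b j) (G.continuous_P_apply i j)
      _).lintegral_lt_top.ne

/-- The expected payment at a stage plus the expected potential after it, in terms of the one-shot
game. -/
lemma stagePay_add_expectedPotential (G : ConcurrentGame n A B) (σ : G.MinStrategy)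
    (τ : G.MaxStrategy) (i₀ : Fin n) (x : Fin n → ℝ) (k : ℕ) :
    G.stagePay σ τ i₀ k + G.expectedPotential σ τ i₀ x (k + 1) =
      ∑ i, ∫ h, ∫ c, G.oneShot x i c.1 c.2 ∂((σ.act k i h).prod (τ.act k i h))
        ∂(G.histLaw σ τ i₀ k i) := by
  have hP : ∀ i j, Integrable (fun q : (Fin k → Stage A B) × (A i × B i) =>
      G.P i q.2.1 q.2.2 j * x j) ((G.histLaw σ τ i₀ k i) ⊗ₘ (σ.act k i ×ₖ τ.act k i)) :=
    fun i j => (integrable_comp_snd i (f := fun a b => G.P i a b j)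
      (G.continuous_P_apply i j) _).mul_const _
  have hpot : G.expectedPotential σ τ i₀ x (k + 1) =
      ∑ i, ∫ q, ∑ j, G.P i q.2.1 q.2.2 j * x j
        ∂((G.histLaw σ τ i₀ k i) ⊗ₘ (σ.act k i ×ₖ τ.act k i)) := by
    simp only [expectedPotential, histLaw_succ_real_univ, Finset.sum_mul]
    rw [Finset.sum_comm]
    refine Finset.sum_congr rfl fun i _ => ?_
    rw [integral_finsetSum _ fun j _ => hP i j]
    simp only [integral_mul_const]
  rw [hpot, stagePay, ← Finset.sum_add_distrib]
  refine Finset.sum_congr rfl fun i _ => ?_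
  rw [← integral_add (integrable_comp_snd i (G.continuous_r i) _)
    (integrable_finsetSum _ fun j _ => hP i j)]
  have h := Measure.integral_compProd (integrable_comp_snd i (G.continuous_oneShot x i)
    ((G.histLaw σ τ i₀ k i) ⊗ₘ (σ.act k i ×ₖ τ.act k i)))
  simp only [Kernel.prod_apply] at h
  exact h

lemma sum_histLaw_real_univ (G : ConcurrentGame n A B) (σ : G.MinStrategy) (τ : G.MaxStrategy)
    (i₀ : Fin n) (k : ℕ) : ∑ i, (G.histLaw σ τ i₀ k i).real Set.univ = 1 := by
  induction k with
  | zero =>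
    rw [Finset.sum_eq_single i₀]
    · simp [histLaw]
    · intro i _ hi
      simp [histLaw, hi]
    · simp
  | succ k ih =>
    rw [← ih]
    simp only [histLaw_succ_real_univ]
    rw [Finset.sum_comm]
    refine Finset.sum_congr rfl fun i _ => ?_
    rw [← integral_finsetSum _ fun j _ => integrable_comp_snd i (f := fun a b => G.P i a b j)
      (G.continuous_P_apply i j) _]
    simp only [G.P_sum, integral_const, smul_eq_mul, mul_one]
    rw [measureReal_def, measureReal_def, Measure.compProd_apply_univ]

lemma abs_expectedPotential_le (G : ConcurrentGame n A B) (σ : G.MinStrategy) (τ : G.MaxStrategy)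
    (i₀ : Fin n) (x : Fin n → ℝ) (k : ℕ) : |G.expectedPotential σ τ i₀ x k| ≤ ‖x‖ := by
  calc |G.expectedPotential σ τ i₀ x k|
      ≤ ∑ i, |(G.histLaw σ τ i₀ k i).real Set.univ * x i| := Finset.abs_sum_le_sum_abs _ _
    _ ≤ ∑ i, (G.histLaw σ τ i₀ k i).real Set.univ * ‖x‖ := by
        refine Finset.sum_le_sum fun i _ => ?_
        rw [abs_mul, abs_of_nonneg measureReal_nonneg]
        exact mul_le_mul_of_nonneg_left (norm_le_pi_norm x i) measureReal_nonneg
    _ = ‖x‖ := by rw [← Finset.sum_mul, sum_histLaw_real_univ, one_mul]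

lemma integrable_integral_oneShot (G : ConcurrentGame n A B) (σ : G.MinStrategy)
    (τ : G.MaxStrategy) (i₀ : Fin n) (x : Fin n → ℝ) (k : ℕ) (i : Fin n) :
    Integrable (fun h => ∫ c, G.oneShot x i c.1 c.2 ∂((σ.act k i h).prod (τ.act k i h)))
      (G.histLaw σ τ i₀ k i) := by
  have h := (integrable_comp_snd i (G.continuous_oneShot x i)
    ((G.histLaw σ τ i₀ k i) ⊗ₘ (σ.act k i ×ₖ τ.act k i)))
  rw [Measure.compProd] at h
  simpa only [Kernel.prod_apply, Kernel.prodMkLeft_apply, Kernel.const_apply] using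
    h.integral_compProd

lemma sum_histLaw_mul_add (G : ConcurrentGame n A B) (σ : G.MinStrategy) (τ : G.MaxStrategy)
    (i₀ : Fin n) (x : Fin n → ℝ) (k : ℕ) (c : ℝ) :
    ∑ i, ∫ _, (x i + c) ∂(G.histLaw σ τ i₀ k i) = G.expectedPotential σ τ i₀ x k + c := by
  simp only [integral_const, smul_eq_mul, mul_add, Finset.sum_add_distrib, ← Finset.sum_mul,
    sum_histLaw_real_univ, one_mul, expectedPotential]

lemma horizonPay_le (G : ConcurrentGame n A B) (σ : G.MinStrategy) (τ : G.MaxStrategy)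
    (i₀ : Fin n) {x : Fin n → ℝ} {c : ℝ}
    (h : ∀ k i h, ∫ c, G.oneShot x i c.1 c.2 ∂((σ.act k i h).prod (τ.act k i h)) ≤ x i + c)
    (N : ℕ) : G.horizonPay σ τ i₀ N ≤ N * c + 2 * ‖x‖ := by
  suffices hN : G.horizonPay σ τ i₀ N + G.expectedPotential σ τ i₀ x N ≤
      N * c + G.expectedPotential σ τ i₀ x 0 by
    have h₁ := abs_le.1 (G.abs_expectedPotential_le σ τ i₀ x N)
    have h₂ := abs_le.1 (G.abs_expectedPotential_le σ τ i₀ x 0)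
    linarith
  induction N with
  | zero => simp [horizonPay]
  | succ N ih =>
    have hstep : G.stagePay σ τ i₀ N + G.expectedPotential σ τ i₀ x (N + 1) ≤
        G.expectedPotential σ τ i₀ x N + c := by
      rw [stagePay_add_expectedPotential, ← sum_histLaw_mul_add]
      exact Finset.sum_le_sum fun i _ => integral_mono (G.integrable_integral_oneShot σ τ i₀ x N i)
        (integrable_const _) fun h' => h N i h'
    rw [horizonPay, Finset.sum_range_succ, ← horizonPay]
    push_cast
    linarith

lemma le_horizonPay (G : ConcurrentGame n A B) (σ : G.MinStrategy) (τ : G.MaxStrategy)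
    (i₀ : Fin n) {x : Fin n → ℝ} {c : ℝ}
    (h : ∀ k i h, x i + c ≤ ∫ c, G.oneShot x i c.1 c.2 ∂((σ.act k i h).prod (τ.act k i h)))
    (N : ℕ) : N * c - 2 * ‖x‖ ≤ G.horizonPay σ τ i₀ N := by
  suffices hN : N * c + G.expectedPotential σ τ i₀ x 0 ≤
      G.horizonPay σ τ i₀ N + G.expectedPotential σ τ i₀ x N by
    have h₁ := abs_le.1 (G.abs_expectedPotential_le σ τ i₀ x N)
    have h₂ := abs_le.1 (G.abs_expectedPotential_le σ τ i₀ x 0)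
    linarith
  induction N with
  | zero => simp [horizonPay]
  | succ N ih =>
    have hstep : G.expectedPotential σ τ i₀ x N + c ≤
        G.stagePay σ τ i₀ N + G.expectedPotential σ τ i₀ x (N + 1) := by
      rw [stagePay_add_expectedPotential, ← sum_histLaw_mul_add]
      exact Finset.sum_le_sum fun i _ => integral_mono (integrable_const _)
        (G.integrable_integral_oneShot σ τ i₀ x N i) fun h' => h N i h'
    rw [horizonPay, Finset.sum_range_succ, ← horizonPay]
    push_cast
    linarith

lemma abs_horizonPay_le (G : ConcurrentGame n A B) (σ : G.MinStrategy) (τ : G.MaxStrategy)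
    (i₀ : Fin n) (N : ℕ) : |G.horizonPay σ τ i₀ N| ≤ N * G.payNorm := by
  have hr : ∀ (i : Fin n) (a : A i) (b : B i), G.oneShot 0 i a b = G.r i a b := by simp [oneShot]
  have hint : ∀ k i h, Integrable (fun c : A i × B i => G.oneShot 0 i c.1 c.2)
      ((σ.act k i h).prod (τ.act k i h)) := fun k i h =>
    integrable_of_continuous_prod (G.continuous_oneShot 0 i) _
  rw [abs_le]
  constructor
  · have := G.le_horizonPay σ τ i₀ (x := 0) (c := -G.payNorm) (fun k i h =>
      le_integral_of_forall_le (hint k i h) fun c => by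
        rw [hr, Pi.zero_apply, zero_add]
        exact (abs_le.1 (G.abs_r_le_payNorm i _ _)).1) N
    simpa using this
  · have := G.horizonPay_le σ τ i₀ (x := 0) (c := G.payNorm) (fun k i h =>
      integral_le_of_forall_le (hint k i h) fun c => by
        rw [hr, Pi.zero_apply, zero_add]
        exact (abs_le.1 (G.abs_r_le_payNorm i _ _)).2) N
    simpa using this

lemma abs_inv_mul_horizonPay_le (G : ConcurrentGame n A B) (σ : G.MinStrategy)
    (τ : G.MaxStrategy) (i₀ : Fin n) {N : ℕ} (hN : 0 < N) :
    |(N : ℝ)⁻¹ * G.horizonPay σ τ i₀ N| ≤ G.payNorm := by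
  have hN' : (0 : ℝ) < N := by exact_mod_cast hN
  rw [abs_mul, abs_of_pos (inv_pos.2 hN'), inv_mul_le_iff₀ hN']
  exact G.abs_horizonPay_le σ τ i₀ N

lemma upperMeanPay_le (G : ConcurrentGame n A B) (σ : G.MinStrategy) (τ : G.MaxStrategy)
    (i₀ : Fin n) {c C : ℝ} (h : ∀ N : ℕ, G.horizonPay σ τ i₀ N ≤ N * c + C) {δ : ℝ} (hδ : 0 < δ) :
    G.upperMeanPay σ τ i₀ ≤ c + δ := by
  -- The means are bounded by the sup-norm of the payments, so that the `limsup` is no junk value.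
  refine limsup_le_of_le ?_ ?_
  · refine IsBoundedUnder.isCoboundedUnder_le ⟨-G.payNorm, ?_⟩
    rw [eventually_map]
    filter_upwards [eventually_gt_atTop 0] with N hN
    exact (abs_le.1 (G.abs_inv_mul_horizonPay_le σ τ i₀ hN)).1
  · obtain ⟨M, hM⟩ := exists_nat_gt (C / δ)
    filter_upwards [eventually_gt_atTop 0, eventually_ge_atTop M] with N hN hMN
    have hN' : (0 : ℝ) < N := by exact_mod_cast hN
    have hMN' : (M : ℝ) ≤ N := by exact_mod_cast hMN
    rw [inv_mul_le_iff₀ hN']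
    have := (div_lt_iff₀ hδ).1 (hM.trans_le hMN')
    linarith [h N]

lemma le_lowerMeanPay (G : ConcurrentGame n A B) (σ : G.MinStrategy) (τ : G.MaxStrategy)
    (i₀ : Fin n) {c C : ℝ} (h : ∀ N : ℕ, N * c - C ≤ G.horizonPay σ τ i₀ N) {δ : ℝ} (hδ : 0 < δ) :
    c - δ ≤ G.lowerMeanPay σ τ i₀ := by
  refine le_liminf_of_le ?_ ?_
  · refine IsBoundedUnder.isCoboundedUnder_ge ⟨G.payNorm, ?_⟩
    rw [eventually_map]
    filter_upwards [eventually_gt_atTop 0] with N hN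
    exact (abs_le.1 (G.abs_inv_mul_horizonPay_le σ τ i₀ hN)).2
  · obtain ⟨M, hM⟩ := exists_nat_gt (C / δ)
    filter_upwards [eventually_gt_atTop 0, eventually_ge_atTop M] with N hN hMN
    have hN' : (0 : ℝ) < N := by exact_mod_cast hN
    have hMN' : (M : ℝ) ≤ N := by exact_mod_cast hMN
    rw [le_inv_mul_iff₀ hN']
    have := (div_lt_iff₀ hδ).1 (hM.trans_le hMN')
    linarith [h N]

variable [∀ i, Nonempty (A i)] [∀ i, Nonempty (B i)]

/-- If `T x = x + χ e`, then `χ` is the value of the mean-payoff game in all states: optimal actions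
of the one-shot games with continuation payoff `x`, up to `δ / 2`, form stationary strategies
that are optimal up to `δ`. -/
lemma isMeanPayoffValue_of_shapley_eq (G : ConcurrentGame n A B) {x : Fin n → ℝ} {χ : ℝ}
    (hx : ∀ i, G.shapley x i = x i + χ) : G.IsMeanPayoffValue fun _ => χ := by
  intro δ hδ
  choose α β hα hβ using fun i => G.exists_nearOptimal x i (half_pos hδ)
  refine ⟨Strategy.stationary _ α, Strategy.stationary _ β, fun τ i₀ => ?_, fun σ i₀ => ?_⟩
  · have h := G.upperMeanPay_le (Strategy.stationary _ α) τ i₀ (G.horizonPay_le _ τ i₀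
      (x := x) (c := χ + δ / 2) fun k i h =>
        integral_prod_le_of_forall_left (G.continuous_oneShot x i) (α i : Measure (A i)) _
          fun b => (hα i b).trans (by rw [hx]; linarith)) (half_pos hδ)
    linarith
  · have h := G.le_lowerMeanPay σ (Strategy.stationary _ β) i₀ (G.le_horizonPay σ _ i₀
      (x := x) (c := χ - δ / 2) fun k i h =>
        le_integral_prod_of_forall_right (G.continuous_oneShot x i) _ (β i : Measure (B i))
          fun a => le_trans (by rw [hx]; linarith) (hβ i a)) (half_pos hδ)
    linarith

end ConcurrentGame

/-! ### Relative value iteration -/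

section RelativeValueIteration

variable {n : ℕ} {S Tt : (Fin n → ℝ) → (Fin n → ℝ)} {η : ℝ}

lemma abs_sub_apply_le_of_norm_sub_le (hTt : ∀ x, ‖Tt x - S x‖ ≤ η) (x : Fin n → ℝ)
    (i : Fin n) : |Tt x i - S x i| ≤ η :=
  (norm_le_pi_norm (Tt x - S x) i).trans (hTt x)

/-- The quantity tested by relative value iteration after `m` executions of the loop body. -/
def rviResidual (Tt : (Fin n → ℝ) → (Fin n → ℝ)) (m : ℕ) : ℝ :=
  hilbertSeminorm (rviIterate Tt m - Tt (rviIterate Tt m))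

/-- If some residual is at most `ε / 3`, the algorithm halts not later than there. -/
lemma exists_rviReturns {ε : ℝ} {N₀ : ℕ} (hN₀ : 1 ≤ N₀) (h : rviResidual Tt N₀ ≤ ε / 3) :
    ∃ (N : ℕ) (x : Fin n → ℝ) (α β : ℝ), N ≤ N₀ ∧ RVIReturns Tt ε N x α β := by
  classical
  have hex : ∃ N, 1 ≤ N ∧ RVIStop Tt ε (rviIterate Tt N) := ⟨N₀, hN₀, h⟩
  refine ⟨Nat.find hex, _, _, _, Nat.find_min' hex ⟨hN₀, h⟩, (Nat.find_spec hex).1,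
    fun k hk hlt hres => Nat.find_min hex hlt ⟨hk, hres⟩, (Nat.find_spec hex).2, rfl, rfl, rfl⟩

variable [Nonempty (Fin n)]

lemma hilbertSeminorm_oracle_sub_le (hTt : ∀ x, ‖Tt x - S x‖ ≤ η) (x : Fin n → ℝ) :
    hilbertSeminorm (Tt x - S x) ≤ 2 * η :=
  hilbertSeminorm_le_of_abs_le fun i => abs_sub_apply_le_of_norm_sub_le hTt x i

lemma hilbertSeminorm_rviIterate_succ_sub (Tt : (Fin n → ℝ) → (Fin n → ℝ)) (m : ℕ)
    (y : Fin n → ℝ) : hilbertSeminorm (rviIterate Tt (m + 1) - y) =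
      hilbertSeminorm (Tt (rviIterate Tt m) - y) :=
  hilbertSeminorm_congr (-topEntry (Tt (rviIterate Tt m))) fun i => by
    simp only [rviIterate, Pi.sub_apply]
    ring

lemma hilbertSeminorm_rviIterate_sub_iterate_le (hTt : ∀ x, ‖Tt x - S x‖ ≤ η)
    (hS : ∀ x y, hilbertSeminorm (S x - S y) ≤ hilbertSeminorm (x - y)) (m k : ℕ) :
    hilbertSeminorm (rviIterate Tt (m + k) - S^[k] (rviIterate Tt m)) ≤ 2 * k * η := by
  induction k with
  | zero =>
    rw [hilbertSeminorm_le_iff]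
    simp
  | succ k ih =>
    rw [← Nat.add_assoc, hilbertSeminorm_rviIterate_succ_sub, Function.iterate_succ_apply']
    have h₁ := hilbertSeminorm_sub_le_add (Tt (rviIterate Tt (m + k)))
      (S (rviIterate Tt (m + k))) (S (S^[k] (rviIterate Tt m)))
    have h₂ := hilbertSeminorm_oracle_sub_le hTt (rviIterate Tt (m + k))
    have h₃ := hS (rviIterate Tt (m + k)) (S^[k] (rviIterate Tt m))
    push_cast
    linarith

lemma rviResidual_eq (Tt : (Fin n → ℝ) → (Fin n → ℝ)) (m : ℕ) :
    rviResidual Tt m = hilbertSeminorm (rviIterate Tt (m + 1) - rviIterate Tt m) := by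
  rw [hilbertSeminorm_rviIterate_succ_sub, rviResidual, hilbertSeminorm_sub_comm]

/-- If the `k`-th iterate contracts by the factor `γ`, so does the residual, up to the noise of the
`2 k` calls of the oracle involved. -/
lemma rviResidual_add_le (hTt : ∀ x, ‖Tt x - S x‖ ≤ η)
    (hS : ∀ x y, hilbertSeminorm (S x - S y) ≤ hilbertSeminorm (x - y)) {k : ℕ} {γ : ℝ}
    (hk : ∀ x y, hilbertSeminorm (S^[k] x - S^[k] y) ≤ γ * hilbertSeminorm (x - y)) (m : ℕ) :
    rviResidual Tt (m + k) ≤ γ * rviResidual Tt m + 4 * k * η := by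
  rw [rviResidual_eq, rviResidual_eq]
  have h₁ := hilbertSeminorm_rviIterate_sub_iterate_le hTt hS (m + 1) k
  have h₂ := hilbertSeminorm_rviIterate_sub_iterate_le hTt hS m k
  rw [hilbertSeminorm_sub_comm] at h₂
  have h₃ := hilbertSeminorm_sub_le_add (rviIterate Tt (m + k + 1))
    (S^[k] (rviIterate Tt (m + 1))) (rviIterate Tt (m + k))
  have h₄ := hilbertSeminorm_sub_le_add (S^[k] (rviIterate Tt (m + 1)))
    (S^[k] (rviIterate Tt m)) (rviIterate Tt (m + k))
  have h₅ := hk (rviIterate Tt (m + 1)) (rviIterate Tt m)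
  rw [show m + 1 + k = m + k + 1 by ring] at h₁
  linarith

lemma rviResidual_mul_le (hTt : ∀ x, ‖Tt x - S x‖ ≤ η)
    (hS : ∀ x y, hilbertSeminorm (S x - S y) ≤ hilbertSeminorm (x - y)) {k : ℕ} {y : ℝ}
    (hy0 : 0 < y) (hy1 : y ≤ 1)
    (hk : ∀ x z, hilbertSeminorm (S^[k] x - S^[k] z) ≤ (1 - y) * hilbertSeminorm (x - z))
    (q : ℕ) : rviResidual Tt (q * k) ≤
      (1 - y) ^ q * rviResidual Tt 0 + 4 * k * η / y * (1 - (1 - y) ^ q) := by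
  induction q with
  | zero => simp
  | succ q ih =>
    rw [Nat.succ_mul]
    have h₁ := rviResidual_add_le hTt hS hk (q * k)
    have h₂ := mul_le_mul_of_nonneg_left ih (sub_nonneg.2 hy1)
    have h₃ : 4 * k * η = 4 * k * η / y * y := by field_simp
    calc rviResidual Tt (q * k + k)
        ≤ (1 - y) * ((1 - y) ^ q * rviResidual Tt 0 + 4 * k * η / y * (1 - (1 - y) ^ q))
          + 4 * k * η / y * y := by linarith
      _ = _ := by ring

lemma rviResidual_zero_le (hTt : ∀ x, ‖Tt x - S x‖ ≤ η) {R : ℝ} (hR : ∀ i, |S 0 i| ≤ R) :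
    rviResidual Tt 0 ≤ 2 * R + 2 * η := by
  have h : rviResidual Tt 0 = hilbertSeminorm (Tt 0) := by
    rw [rviResidual, rviIterate, hilbertSeminorm_sub_comm, sub_zero]
  rw [h]
  have h₁ := hilbertSeminorm_add_le (Tt 0 - S 0) (S 0)
  rw [sub_add_cancel] at h₁
  have h₂ := hilbertSeminorm_oracle_sub_le hTt 0
  have h₃ := hilbertSeminorm_le_of_abs_le hR
  linarith

/-- The residual falls below `ε / 3` after one iteration or within `L k / y` iterations, where
`L` is the logarithm of `12 R / ε`. -/
lemma exists_rviResidual_le (hTt : ∀ x, ‖Tt x - S x‖ ≤ η)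
    (hS : ∀ x y, hilbertSeminorm (S x - S y) ≤ hilbertSeminorm (x - y)) {k : ℕ} {y : ℝ}
    (hk1 : 1 ≤ k) (hy0 : 0 < y) (hy : y ≤ (1 / 2) ^ k)
    (hk : ∀ x z, hilbertSeminorm (S^[k] x - S^[k] z) ≤ (1 - y) * hilbertSeminorm (x - z))
    {R : ℝ} (hR : ∀ i, |S 0 i| ≤ R) {ε : ℝ} (hη : 0 < η) (hε : η * (12 + 24 * k / y) ≤ ε) :
    ∃ N : ℕ, 1 ≤ N ∧ rviResidual Tt N ≤ ε / 3 ∧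
      (N = 1 ∨ 0 < R ∧ (N : ℝ) ≤ Real.log (12 * R / ε) * k * y⁻¹) := by
  have hk1' : (1 : ℝ) ≤ k := by exact_mod_cast hk1
  have hy2 : y ≤ 1 / 2 := hy.trans (pow_le_of_le_one (by norm_num) (by norm_num) (by omega))
  have hR0 : 0 ≤ R := (abs_nonneg _).trans (hR (Classical.arbitrary _))
  have hnoise : 2 * η + 4 * k * η / y ≤ ε / 6 := by
    have : 4 * k * η / y = η * (24 * k / y) / 6 := by ring
    linarith
  -- When `k = 1`, the noise of one step is the part `y` of the total noise `4 k η / y`.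
  have hky : 4 * k * η / y * y = 4 * k * η := by field_simp
  have hkyη : 4 * η ≤ y * (4 * k * η / y) := by nlinarith
  have hQ0 : 0 < 4 * k * η / y := by positivity
  have hε0 : 0 < ε := by linarith
  have h0 := rviResidual_zero_le hTt hR
  rcases le_or_gt (12 * R) (ε * Real.exp y) with hcase | hcase
  -- If `L ≤ y`, the first iteration suffices. For `k ≥ 2` it need not contract, but then
  -- `y ≤ 1 / 4` leaves room for the initial residual and for the noise.
  · refine ⟨1, le_rfl, ?_, Or.inl rfl⟩
    rcases eq_or_lt_of_le hk1 with rfl | hk2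
    · have h₁ := rviResidual_mul_le hTt hS hy0 (by linarith) hk 1
      simp only [one_mul, pow_one] at h₁
      have h₂ : (1 - y) * Real.exp y ≤ 1 := by
        have := mul_le_mul_of_nonneg_right (Real.one_sub_le_exp_neg y) (Real.exp_pos y).le
        rwa [← Real.exp_add, neg_add_cancel, Real.exp_zero] at this
      have h₃ := mul_le_mul_of_nonneg_left hcase (by linarith : 0 ≤ 1 - y)
      have h₄ := mul_le_mul_of_nonneg_left h0 (by linarith : 0 ≤ 1 - y)
      have h₅ := mul_le_mul_of_nonneg_left h₂ hε0.le
      nlinarith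
    · have h₁ := rviResidual_add_le hTt hS (k := 1) (γ := 1)
        (fun x z => by simpa using hS x z) 0
      have hk2' : (2 : ℝ) ≤ k := by exact_mod_cast hk2
      have hy4 : y ≤ 1 / 4 := hy.trans
        ((pow_le_pow_of_le_one (by norm_num) (by norm_num) hk2).trans (by norm_num))
      have h₂ : Real.exp y ≤ 1 + 1 / 2 := by
        have := Real.one_sub_le_exp_neg y
        rw [Real.exp_neg] at this
        have h₃ := Real.exp_pos y
        have h₄ : (1 - y) * Real.exp y ≤ 1 := by
          have := mul_le_mul_of_nonneg_right this h₃.le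
          rwa [inv_mul_cancel₀ h₃.ne'] at this
        nlinarith
      have h₃ := mul_le_mul_of_nonneg_left h₂ hε0.le
      simp only [zero_add, Nat.cast_one, mul_one, one_mul] at h₁
      have h₄ : 32 * η ≤ 4 * k * η / y := by
        rw [le_div_iff₀ hy0]
        nlinarith
      linarith
  -- Otherwise, `⌊L / y⌋` rounds of `k` iterations suffice.
  · have hRpos : 0 < R := by
      have := mul_pos hε0 (Real.exp_pos y)
      linarith
    set L := Real.log (12 * R / ε) with hL
    have hexpL : Real.exp L = 12 * R / ε := Real.exp_log (by positivity)
    have hyL : y < L := by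
      rw [hL, Real.lt_log_iff_exp_lt (by positivity), lt_div_iff₀ hε0]
      linarith
    set q := ⌊L / y⌋₊ with hq
    have hq1 : 1 ≤ q := by
      rw [hq, Nat.one_le_floor_iff, one_le_div hy0]
      exact hyL.le
    have hqle : (q : ℝ) ≤ L / y := Nat.floor_le (div_nonneg (by linarith) hy0.le)
    have hlt : L ≤ (q + 1) * y := ((div_lt_iff₀ hy0).1 (Nat.lt_floor_add_one _)).le
    refine ⟨q * k, Nat.mul_pos hq1 hk1, ?_, Or.inr ⟨hRpos, ?_⟩⟩
    · have h₁ := rviResidual_mul_le hTt hS hy0 (by linarith) hk q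
      have hc : 12 * η / ε ≤ 1 / 2 := by
        rw [div_le_div_iff₀ hε0 two_pos]
        nlinarith
      have h₂ := one_sub_pow_mul_exp_le hy0 hy2 hq1 hlt (by positivity) hc
      rw [hexpL] at h₂
      set g := (1 - y) ^ q
      have hg0 : 0 ≤ g := pow_nonneg (by linarith) q
      have hg1 : g ≤ 1 := pow_le_one₀ (by linarith) (by linarith)
      have h₃ := mul_le_mul_of_nonneg_left h0 hg0
      have h₄ := mul_le_mul_of_nonneg_right (by linarith : 4 * k * η / y ≤ ε / 6 - 2 * η)
        (sub_nonneg.2 hg1)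
      have h₅ : (g * (12 * R / ε - 1) + 12 * η / ε * (2 * g - 1)) * (ε / 6) =
          g * (2 * R) - g * (ε / 6) + 2 * η * (2 * g - 1) := by
        field_simp
        ring
      have h₆ := mul_le_mul_of_nonneg_right h₂ (by linarith : 0 ≤ ε / 6)
      rw [h₅] at h₆
      linarith
    · push_cast
      calc (q : ℝ) * k ≤ L / y * k := mul_le_mul_of_nonneg_right hqle (by linarith)
        _ = L * k * y⁻¹ := by ring

end RelativeValueIteration

end

theorem mainTheorem2 {n : ℕ} {A : Fin n → Type u} {B : Fin n → Type v}
    [∀ i, TopologicalSpace (A i)] [∀ i, CompactSpace (A i)] [∀ i, Nonempty (A i)]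
    [∀ i, MeasurableSpace (A i)] [∀ i, BorelSpace (A i)]
    [∀ i, TopologicalSpace (B i)] [∀ i, CompactSpace (B i)] [∀ i, Nonempty (B i)]
    [∀ i, MeasurableSpace (B i)] [∀ i, BorelSpace (B i)]
    (G : ConcurrentGame n A B) (hG : G.IsUnichain)
    (hp : IsLeast G.offDiagPos G.pMin) :
    ∃ χ : ℝ, G.IsMeanPayoffValue (fun _ => χ) ∧
      ∀ (ε η : ℝ), 0 < ε → ε < 1 → 0 < η →
        η * (12 + 24 * G.unichainIndex / (1 - (1 - G.theta ^ G.unichainIndex))) ≤ ε →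
      ∀ Tt : (Fin n → ℝ) → (Fin n → ℝ), (∀ x, ‖Tt x - G.dampedShapley x‖ ≤ η) →
        ∃ (N : ℕ) (x : Fin n → ℝ) (α β : ℝ), RVIReturns Tt ε N x α β ∧
          (N = 1 ∨ (0 < G.payNorm ∧
            (N : ℝ) ≤ (|Real.log ε| + Real.log (1 - G.theta) + Real.log 12
              + Real.log G.payNorm) * G.unichainIndex * (G.theta ^ G.unichainIndex)⁻¹)) ∧
          ((1 - G.theta) * χ ∈ Set.Icc (α - ε / 3) (β + ε / 3) ∧
            (β + ε / 3) - (α - ε / 3) ≤ ε) ∧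
          ∀ μ ∈ Set.Icc α β, |μ / (1 - G.theta) - χ| ≤ ε := by
  have : Nonempty (Fin n) := ⟨⟨0, by linarith [G.two_le_of_isLeast hp]⟩⟩
  have hθ0 := G.theta_pos hp
  have hθ1 := G.theta_le_half hp
  have hk1 := (G.unichainIndex_spec hG hp).1
  obtain ⟨z, χ, hz⟩ := G.exists_shapley_eq_add_const hG hp
  refine ⟨χ, G.isMeanPayoffValue_of_shapley_eq hz, fun ε η hε0 hε1 hη hηε Tt hTt => ?_⟩
  rw [sub_sub_cancel] at hηε
  have hy0 : 0 < G.theta ^ G.unichainIndex := pow_pos hθ0 _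
  have hS0 : ∀ i, |G.dampedShapley 0 i| ≤ (1 - G.theta) * G.payNorm := by
    intro i
    have h : G.dampedShapley 0 i = (1 - G.theta) * G.shapley 0 i := by
      simp [ConcurrentGame.dampedShapley]
    rw [h, abs_mul, abs_of_pos (by linarith)]
    exact mul_le_mul_of_nonneg_left (G.abs_shapley_zero_le i) (by linarith)
  obtain ⟨N₀, hN₀, hres, hcount⟩ := exists_rviResidual_le hTt
    (G.hilbertSeminorm_dampedShapley_sub_le hθ0.le (by linarith)) hk1 hy0
    (pow_le_pow_left₀ hθ0.le hθ1 _) (G.hilbertSeminorm_iterate_dampedShapley_le hG hp) hS0 hη hηε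
  obtain ⟨N, x, α, β, hN, hret⟩ := exists_rviReturns hN₀ hres
  -- The residual of `x` encloses the eigenvalue `(1 - θ) χ` up to the noise `η`.
  have hdz : ∀ i, G.dampedShapley z i = z i + (1 - G.theta) * χ := by
    intro i
    simp only [ConcurrentGame.dampedShapley, Pi.add_apply, Pi.smul_apply, smul_eq_mul, hz]
    ring
  have hα : ∀ i, α ≤ Tt x i - x i := fun i => hret.lower ▸ botEntry_le (Tt x - x) i
  have hβ : ∀ i, Tt x i - x i ≤ β := fun i => hret.upper ▸ le_topEntry (Tt x - x) i
  have hlow : α - η ≤ (1 - G.theta) * χ := by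
    obtain ⟨i, hi⟩ := exists_eq_topEntry (x - z)
    have hmono := G.dampedShapley_mono hθ0.le (by linarith) (x := x)
      (y := fun j => z j + topEntry (x - z)) (fun j => by
        have := le_topEntry (x - z) j
        simp only [Pi.sub_apply] at this
        linarith) i
    rw [G.dampedShapley_add_const] at hmono
    beta_reduce at hmono
    rw [hdz, ← hi] at hmono
    have h₁ := (abs_le.1 (abs_sub_apply_le_of_norm_sub_le hTt x i)).2
    simp only [Pi.sub_apply] at hmono
    linarith [hα i]
  have hupp : (1 - G.theta) * χ ≤ β + η := by
    obtain ⟨i, hi⟩ := exists_eq_botEntry (x - z)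
    have hmono := G.dampedShapley_mono hθ0.le (by linarith)
      (x := fun j => z j + botEntry (x - z)) (y := x) (fun j => by
        have := botEntry_le (x - z) j
        simp only [Pi.sub_apply] at this
        linarith) i
    rw [G.dampedShapley_add_const] at hmono
    beta_reduce at hmono
    rw [hdz, ← hi] at hmono
    have h₁ := (abs_le.1 (abs_sub_apply_le_of_norm_sub_le hTt x i)).1
    simp only [Pi.sub_apply] at hmono
    linarith [hβ i]
  have hlen : β - α ≤ ε / 3 := by
    have h : hilbertSeminorm (x - Tt x) ≤ ε / 3 := hret.result ▸ hret.stops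
    rw [hilbertSeminorm_sub_comm] at h
    rw [hret.upper, hret.lower]
    exact h
  have hη36 : 12 * η ≤ ε := by
    have : 0 ≤ η * (24 * G.unichainIndex / G.theta ^ G.unichainIndex) := by positivity
    linarith
  refine ⟨N, x, α, β, hret, ?_, ⟨⟨by linarith, by linarith⟩, by linarith⟩, fun μ hμ => ?_⟩
  · rcases hcount with rfl | ⟨hR, hle⟩
    · exact Or.inl (le_antisymm hN hret.one_le)
    · have hpay : 0 < G.payNorm := pos_of_mul_pos_right hR (by linarith)
      refine Or.inr ⟨hpay, (by exact_mod_cast hN : (N : ℝ) ≤ N₀).trans (hle.trans_eq ?_)⟩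
      rw [Real.log_div (by positivity) hε0.ne', Real.log_mul (by norm_num) hR.ne',
        Real.log_mul (by linarith) hpay.ne', abs_of_neg (Real.log_neg hε0 hε1)]
      ring
  · have h1θ : 0 < 1 - G.theta := by linarith
    have h₁ : |μ - (1 - G.theta) * χ| ≤ ε / 3 + η :=
      abs_le.2 ⟨by linarith [hμ.1], by linarith [hμ.2]⟩
    have h₂ : μ / (1 - G.theta) - χ = (μ - (1 - G.theta) * χ) / (1 - G.theta) := by
      field_simp
    rw [h₂, abs_div, abs_of_pos h1θ, div_le_iff₀ h1θ]
    nlinarith
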